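/- **Model.** Let $d\in\mathbb N$, $\tau>2$, $\alpha>1$. On the torus $\mathbb T^d=\mathbb R^d/\mathbb Z^d$ let $\|x-y\|_{\min}=\min_{1\le i\le d}|x_i-y_i|_T$, where $|a-b|_T=\min\{|a-b|,1-|a-b|\}$, and let $V_{\min}(r)$ be the volume of $\{x\in\mathbb T^d:\|x\|_{\min}\le r\}$. A power law on $[1,\infty)$ with exponent $\tau$ is a probability distribution $\mathcal D$ that is either supported on $\{1,2,\dots\}$ with $\mathcal D(\{k\})=\Theta(k^{-\tau})$ for $k\ge 1$, or has a density $f$ that vanishes below $1$ and satisfies $f(x)=\Theta(x^{-\tau})$ for $x\ge1$. An MCD-GIRG $\mathcal G$ on $\mathcal V=[n]$ is obtained as follows: all vertices draw i.i.d. weights $w_v\sim\mathcal D$ and independent, uniformly distributed positions $x_v\in\mathbb T^d$; given these, each pair of distinct vertices $u,v$ is joined independently with a probability $$p_{uv}=\Theta\Big(\min\Big\{\tfrac{w_uw_v}{n\,V_{\min}(\|x_u-x_v\|_{\min})},1\Big\}^{\alpha}\Big),$$ where the hidden constants are uniform over $n$, $u,v$, weights and positions, and $p_{uv}$ is otherwise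 an arbitrary measurable function of $n$, $u,v$ and the weights and positions of $u$ and $v$. Call the model *asymptotically homogeneous* if there is a fixed measurable function $h$ with $p_{uv}=(1+o(1))\,h\big(\tfrac{w_uw_v}{n V_{\min}(\|x_u-x_v\|_{\min})}\big)$ as $n\to\infty$, uniformly over all pairs, weights and positions. For a graph $H$ and a vertex set $S$, $N_{ext}(S)$ is the set of vertices of $H$ outside $S$ with a neighbour in $S$, and $S$ is $\zeta$-expanding for $H$ if $|N_{ext}(S)|\ge\zeta|S|$. "Whp" means with probability tending to $1$ as $n\to\infty$. **Theorem.** For each $d\ge2$ there is $c_d>1$ such that the following holds. Let $\tau\in(2,3)$, $\alpha>1$, $\gamma>\frac1{3-\tau}$, and let $\mathcal G$ be an MCD-GIRG with these parameters. For a (random) vertex set $\mathcal V'\subseteq\mathcal V$, let $(\ast)$ be the statement: there is a constant $\varepsilon>0$ such that whp every nonempty $S\subseteq\mathcal V'$ with $|S|\le\varepsilon|\mathcal V'|$ is $\zeta$-expanding for the subgraph of $\mathcal G$ induced by $\mathcal V'$, with $$\zeta=\varepsilon\cdot\min\Big\{\log^{\gamma(3-\tau)}n,\ \Big(\tfrac{|\mathcal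 V'|}{|S|}\Big)^{1-1/c_d}\Big\}.$$ 1. For all constants $c'>0$, $(\ast)$ holds for the set $\mathcal V'$ of vertices of weight at least $c'\log^\gamma n$. 2. For all constants $c_2'>c_1'>0$, $(\ast)$ holds for the set of vertices of weight in $[c_1'\log^\gamma n,c_2'\log^\gamma n]$. 3. For all constants $c'>0$, $(\ast)$ holds for the set of vertices of degree in $\mathcal G$ at least $c'\log^\gamma n$. 4. There is $R\ge1$ (depending on the model) such that for all constants $c_1'>0$ and $c_2'>Rc_1'$, $(\ast)$ holds for the set of vertices of degree in $\mathcal G$ in $[c_1'\log^\gamma n,c_2'\log^\gamma n]$. If the model is asymptotically homogeneous, this is true for all constants $c_2'>c_1'>0$. -/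

import Mathlib

open Filter MeasureTheory Topology

/-- The `d`-dimensional torus `ℝ^d / ℤ^d`. Its `volume` is the uniform distribution. -/
abbrev Torus (d : ℕ) : Type := Fin d → UnitAddCircle

/-- `minNorm x = min_i |x_i|_T`. The norm of `UnitAddCircle` is the distance to `0` on the circle of
length one, so that `minNorm (x - y)` is the minimum-component distance of `x` and `y`. -/
noncomputable def minNorm {d : ℕ} (x : Torus d) : ℝ := ⨅ i, ‖x i‖

/-- The volume of the ball of radius `r` in the minimum-component distance. -/
noncomputable def volMin (d : ℕ) (r : ℝ) : ℝ := volume.real {x : Torus d | minNorm x ≤ r}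

/-- The quantity `w_u w_v / (n · V_min(‖x_u - x_v‖_min))`. It is used only if the
minimum-component distance of the two positions is not `0`, which holds almost surely. -/
noncomputable def tieRatio {d : ℕ} (n : ℕ) (w w' : ℝ) (x y : Torus d) : ℝ :=
  w * w' / (n * volMin d (minNorm (x - y)))

/-- Discrete power law on `{1, 2, …}`: `ℙ(X = k) = Θ(k^{-τ})`. -/
def IsDiscretePowerLaw (τ : ℝ) (D : Measure ℝ) : Prop :=
  D (Set.range (fun k : ℕ => (k : ℝ)))ᶜ = 0 ∧
    ∃ c C : ℝ, 0 < c ∧ 0 < C ∧ ∀ k : ℕ, 1 ≤ k →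
      c * (k : ℝ) ^ (-τ) ≤ D.real {(k : ℝ)} ∧ D.real {(k : ℝ)} ≤ C * (k : ℝ) ^ (-τ)

/-- Continuous power law: a density `f` with `f(x) = Θ(x^{-τ})` for `x ≥ 1`. -/
def IsContinuousPowerLaw (τ : ℝ) (D : Measure ℝ) : Prop :=
  ∃ f : ℝ → ℝ, Measurable f ∧ (∀ x, 0 ≤ f x) ∧
    D = volume.withDensity (fun x => ENNReal.ofReal (f x)) ∧
    ∃ c C : ℝ, 0 < c ∧ 0 < C ∧ ∀ x : ℝ, 1 ≤ x →
      c * x ^ (-τ) ≤ f x ∧ f x ≤ C * x ^ (-τ)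

/-- A power-law probability distribution on `[1, ∞)` with exponent `τ`. -/
def IsPowerLaw (τ : ℝ) (D : Measure ℝ) : Prop :=
  IsProbabilityMeasure D ∧ D (Set.Ici 1)ᶜ = 0 ∧
    (IsDiscretePowerLaw τ D ∨ IsContinuousPowerLaw τ D)

/-- The parameters of an MCD-GIRG of dimension `d`, power-law exponent `τ` and geometry parameter
`α`, for all numbers `n` of vertices: the weight distribution, and the function giving the
probability of the edge `uv` from the weights and positions of `u` and `v`. This function is
`Θ(min {w_u w_v / (n V_min(‖x_u - x_v‖_min)), 1}^α)` with uniform constants, otherwise arbitrary. -/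
structure MCDGIRG (d : ℕ) (τ α : ℝ) where
  weightLaw : Measure ℝ
  isPowerLaw : IsPowerLaw τ weightLaw
  prob : (n : ℕ) → Fin n → Fin n → ℝ → ℝ → Torus d → Torus d → ℝ
  prob_mem : ∀ n u v w w' x y, prob n u v w w' x y ∈ Set.Icc (0 : ℝ) 1
  prob_symm : ∀ n u v w w' x y, prob n u v w w' x y = prob n v u w' w y x
  prob_measurable : ∀ n u v, Measurable
    fun q : (ℝ × ℝ) × (Torus d × Torus d) => prob n u v q.1.1 q.1.2 q.2.1 q.2.2
  prob_theta : ∃ c C : ℝ, 0 < c ∧ 0 < C ∧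
    ∀ (n : ℕ) (u v : Fin n), u ≠ v → ∀ w w' : ℝ, 1 ≤ w → 1 ≤ w' →
      ∀ x y : Torus d, minNorm (x - y) ≠ 0 →
        c * (min (tieRatio n w w' x y) 1) ^ α ≤ prob n u v w w' x y ∧
        prob n u v w w' x y ≤ C * (min (tieRatio n w w' x y) 1) ^ α

/-- An outcome: the weights, the positions, and for every pair `uv` an auxiliary number in
`[0, 1]` that decides whether the edge `uv` is present. -/
abbrev Sample (d n : ℕ) : Type :=
  (Fin n → ℝ) × (Fin n → Torus d) × (Sym2 (Fin n) → unitInterval)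

namespace MCDGIRG

variable {d : ℕ} {τ α : ℝ}

/-- The weights are i.i.d. with the weight distribution, the positions and the auxiliary numbers
are i.i.d. uniform, and all of these are independent. -/
noncomputable def law (M : MCDGIRG d τ α) (n : ℕ) : Measure (Sample d n) :=
  (Measure.pi fun _ : Fin n => M.weightLaw).prod
    ((volume : Measure (Fin n → Torus d)).prod
      (volume : Measure (Sym2 (Fin n) → unitInterval)))

/-- The MCD-GIRG: given weights and positions, distinct `u` and `v` are joined independently
with probability `prob n u v w_u w_v x_u x_v`. -/
def graph (M : MCDGIRG d τ α) {n : ℕ} (ω : Sample d n) : SimpleGraph (Fin n) where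
  Adj u v := u ≠ v ∧ (ω.2.2 s(u, v) : ℝ) < M.prob n u v (ω.1 u) (ω.1 v) (ω.2.1 u) (ω.2.1 v)
  symm := ⟨fun u v h => ⟨h.1.symm, by rw [Sym2.eq_swap, M.prob_symm]; exact h.2⟩⟩
  loopless := ⟨fun _ h => h.1 rfl⟩

/-- An event that depends on `n` holds with high probability. -/
def Whp (M : MCDGIRG d τ α) (E : (n : ℕ) → Set (Sample d n)) : Prop :=
  Tendsto (fun n => M.law n (E n)) atTop (𝓝 1)

/-- The vertices with weight at least `c' log^γ n`. -/
def weightAtLeast (_M : MCDGIRG d τ α) (γ c' : ℝ) (n : ℕ) (ω : Sample d n) : Set (Fin n) :=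
  {v | c' * Real.log n ^ γ ≤ ω.1 v}

/-- The vertices with weight in `[c₁' log^γ n, c₂' log^γ n]`. -/
def weightIn (_M : MCDGIRG d τ α) (γ c₁' c₂' : ℝ) (n : ℕ) (ω : Sample d n) : Set (Fin n) :=
  {v | ω.1 v ∈ Set.Icc (c₁' * Real.log n ^ γ) (c₂' * Real.log n ^ γ)}

/-- The degree of a vertex in the whole MCD-GIRG. -/
noncomputable def deg (M : MCDGIRG d τ α) {n : ℕ} (ω : Sample d n) (v : Fin n) : ℕ :=
  ((M.graph ω).neighborSet v).ncard

/-- The vertices with degree at least `c' log^γ n`. -/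
def degreeAtLeast (M : MCDGIRG d τ α) (γ c' : ℝ) (n : ℕ) (ω : Sample d n) : Set (Fin n) :=
  {v | c' * Real.log n ^ γ ≤ M.deg ω v}

/-- The vertices with degree in `[c₁' log^γ n, c₂' log^γ n]`. -/
def degreeIn (M : MCDGIRG d τ α) (γ c₁' c₂' : ℝ) (n : ℕ) (ω : Sample d n) : Set (Fin n) :=
  {v | (M.deg ω v : ℝ) ∈ Set.Icc (c₁' * Real.log n ^ γ) (c₂' * Real.log n ^ γ)}

/-- Up to a factor `1 + o(1)`, uniform over all pairs, weights and positions, the edge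
probability is a fixed function of `w_u w_v / (n V_min(‖x_u - x_v‖_min))`. -/
def AsymptoticallyHomogeneous (M : MCDGIRG d τ α) : Prop :=
  ∃ h : ℝ → ℝ, Measurable h ∧ ∀ δ : ℝ, 0 < δ → ∀ᶠ n : ℕ in atTop,
    ∀ u v : Fin n, u ≠ v → ∀ w w' : ℝ, 1 ≤ w → 1 ≤ w' →
      ∀ x y : Torus d, minNorm (x - y) ≠ 0 →
        |M.prob n u v w w' x y - h (tieRatio n w w' x y)| ≤ δ * h (tieRatio n w w' x y)

end MCDGIRG

/-- The external neighbourhood of a vertex set. -/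
def extNbhd {V : Type*} (G : SimpleGraph V) (S : Set V) : Set V :=
  {v | v ∉ S ∧ ∃ u ∈ S, G.Adj u v}

/-- `S` is a `ζ`-expanding set for the (finite) graph `G`. -/
def IsExpandingSet {V : Type*} (G : SimpleGraph V) (ζ : ℝ) (S : Set V) : Prop :=
  ζ * S.ncard ≤ (extNbhd G S).ncard

/-- With high probability, all nonempty `S ⊆ V'` with `|S| ≤ ε |V'|` are expanding sets for the
subgraph induced by the random vertex set `V'`, with expansion factor
`ε · min {log^{γ(3-τ)} n, (|V'| / |S|)^{1 - 1/c}}`. -/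
def MCDGIRG.WhpExpander {d : ℕ} {τ α : ℝ} (M : MCDGIRG d τ α) (c γ ε : ℝ)
    (V' : (n : ℕ) → Sample d n → Set (Fin n)) : Prop :=
  M.Whp fun n => {ω | ∀ S : Set (V' n ω), S.Nonempty →
    (S.ncard : ℝ) ≤ ε * (V' n ω).ncard →
      IsExpandingSet ((M.graph ω).induce (V' n ω))
        (ε * min (Real.log n ^ (γ * (3 - τ)))
          (((V' n ω).ncard / S.ncard : ℝ) ^ (1 - 1 / c))) S}

/-! Write ℓ = log^γ n and K = ℓ^(3-τ), and cut two of the coordinate circles into m ≈ n/ℓ² arcs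
each. Two vertices of weight at least of order ℓ that share an arc in one of these coordinates have
minimum-component distance at most 1/m, hence a tie ratio bounded below, and are joined with
probability bounded away from 0 (`exists_le_edgeProb_of_arcIndex_eq`). An arc carries about (n/m)
ℓ^(1-τ) ≈ K vertices with weight in a window at scale ℓ. As γ(3-τ) > 1, K dominates log n, so
Chernoff and a union bound give every heavy vertex at least κK neighbours on its own arc, in each of
the two coordinates (`exists_overwhelming_le_ncard_nbhd`).

Let S have s elements and meet a arcs in the coordinate where it meets more. Neighbourhoods on
distinct arcs are disjoint, so S and its neighbourhood together have at least κKa elements. To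
compare a with s, note that S lies in a rectangle of a × a cells. The two coordinates are
independent, so such a rectangle has O(K a · a/m) heavy vertices on average, and a union bound over
all rectangles with a ≤ δm shows that each has at most max(20a, K a √(a/m))
(`exists_overwhelming_rectangle_le`). If s ≤ 20a, the expansion factor is of order K. Otherwise X =
Ka/s is at least √(m/a), and |V'|/s = O(Km/s) = O(X · m/a) = O(X³), so the factor is at least of
order (|V'|/s)^(1/3). If a > δm, the neighbourhood is a constant proportion of V'. Thus c_d = 3/2
serves for every d ≥ 2. The deterministic part is `isExpandingSet_of_two_partitions`.

About V' this uses only that it contains a whole weight window at scale ℓ and no vertex of weight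
below c₀ℓ (`exists_whpExpander_of_sandwich`). For degree-defined sets this follows from
concentration: a vertex of weight w = o(n) has mean degree between aw and bw, so degrees in [c₁ℓ,
c₂ℓ] capture a weight window as soon as c₂/c₁ > b/a. In the homogeneous case the mean degree is (θ +
o(1))w, and b/a can be taken arbitrarily close to 1. -/

instance isProbabilityMeasure_unitAddCircle :
    IsProbabilityMeasure (volume : Measure UnitAddCircle) := ⟨UnitAddCircle.measure_univ⟩

instance isProbabilityMeasure_torus (d : ℕ) :
    IsProbabilityMeasure (volume : Measure (Torus d)) :=
  inferInstanceAs (IsProbabilityMeasure (Measure.pi fun _ : Fin d => (volume : Measure UnitAddCircle)))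

/-! ### Arcs of the circle and volumes of minimum-component balls -/

section TorusGeometry

variable {d : ℕ}

/-- The index in `{0, …, m - 1}` of the arc of length `1 / m` that contains `x`. -/
noncomputable def arcIndex (m : ℕ) (x : UnitAddCircle) : ℕ :=
  ⌈m * (AddCircle.equivIoc 1 0 x : ℝ)⌉₊ - 1

lemma arcIndex_coe {m : ℕ} {t : ℝ} (ht : t ∈ Set.Ioc (0 : ℝ) 1) :
    arcIndex m (t : UnitAddCircle) = ⌈m * t⌉₊ - 1 := by
  have : t ∈ Set.Ioc (0 : ℝ) (0 + 1) := by simpa using ht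
  rw [arcIndex, AddCircle.equivIoc_coe_eq this]

lemma measurable_arcIndex (m : ℕ) : Measurable (arcIndex m) := by
  have h1 : Measurable fun x : UnitAddCircle => (AddCircle.equivIoc 1 0 x : ℝ) :=
    measurable_subtype_coe.comp (AddCircle.measurableEquivIoc 1 0).measurable
  have h2 : Measurable fun x : UnitAddCircle => ⌈m * (AddCircle.equivIoc 1 0 x : ℝ)⌉₊ :=
    Nat.measurable_ceil.comp (h1.const_mul _)
  exact (measurable_from_top (f := fun k : ℕ => k - 1)).comp h2

/-- The representative lies in (0, 1], so the arcs are open on the left and closed on the right. The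
ceiling is positive, so the truncated subtraction in `arcIndex` loses nothing. -/
lemma arcIndex_eq_iff {m : ℕ} (hm : 0 < m) {t : ℝ} (ht : t ∈ Set.Ioc (0 : ℝ) 1) (j : ℕ) :
    arcIndex m (t : UnitAddCircle) = j ↔ t ∈ Set.Ioc ((j : ℝ) / m) ((j + 1) / m) := by
  have hm' : (0 : ℝ) < m := by exact_mod_cast hm
  rw [arcIndex_coe ht]
  have hpos : 0 < ⌈m * t⌉₊ := Nat.ceil_pos.2 (mul_pos hm' ht.1)
  rw [show ⌈m * t⌉₊ - 1 = j ↔ ⌈m * t⌉₊ = j + 1 by omega, Nat.ceil_eq_iff (by omega)]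
  simp only [Set.mem_Ioc, div_lt_iff₀ hm', le_div_iff₀ hm']
  push_cast
  simp [mul_comm]

lemma exists_coe_eq (x : UnitAddCircle) : ∃ t ∈ Set.Ioc (0 : ℝ) 1, (t : UnitAddCircle) = x := by
  refine ⟨AddCircle.equivIoc 1 0 x, by simpa using (AddCircle.equivIoc 1 0 x).2, ?_⟩
  exact AddCircle.coe_equivIoc

lemma arcIndex_lt {m : ℕ} (hm : 0 < m) (x : UnitAddCircle) : arcIndex m x < m := by
  obtain ⟨t, ht, rfl⟩ := exists_coe_eq x
  have hm' : (0 : ℝ) < m := by exact_mod_cast hm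
  have h := ((arcIndex_eq_iff hm ht _).1 rfl).1
  rw [div_lt_iff₀ hm'] at h
  have : (arcIndex m (t : UnitAddCircle) : ℝ) < m := h.trans_le (by nlinarith [ht.2])
  exact_mod_cast this

lemma volume_arcIndex_eq {m : ℕ} {j : ℕ} (hj : j < m) :
    volume {x : UnitAddCircle | arcIndex m x = j} = ENNReal.ofReal (1 / m) := by
  have hm : 0 < m := by omega
  have hm' : (0 : ℝ) < m := by exact_mod_cast hm
  have hms : MeasurableSet {x : UnitAddCircle | arcIndex m x = j} :=
    measurable_arcIndex m (measurableSet_singleton j)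
  rw [AddCircle.add_projection_respects_measure 1 0 hms]
  have : QuotientAddGroup.mk ⁻¹' {x : UnitAddCircle | arcIndex m x = j} ∩ Set.Ioc 0 (0 + 1)
      = Set.Ioc ((j : ℝ) / m) ((j + 1) / m) := by
    ext t
    constructor
    · rintro ⟨h1, h2⟩
      exact (arcIndex_eq_iff hm (by simpa using h2) j).1 h1
    · intro h
      have ht : t ∈ Set.Ioc (0 : ℝ) 1 := by
        refine ⟨lt_of_le_of_lt (by positivity) h.1, h.2.trans ?_⟩
        rw [div_le_one hm']
        exact_mod_cast hj
      exact ⟨(arcIndex_eq_iff hm ht j).2 h, by simpa using ht⟩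
  rw [this, Real.volume_Ioc]
  congr 1
  ring

lemma volume_arcIndex_mem {m : ℕ} {A : Finset ℕ} (hA : A ⊆ Finset.range m) :
    volume {x : UnitAddCircle | arcIndex m x ∈ A} = ENNReal.ofReal (A.card / m) := by
  have h : {x : UnitAddCircle | arcIndex m x ∈ A} = ⋃ j ∈ A, {x | arcIndex m x = j} := by
    ext x; simp
  rw [h, measure_biUnion_finset]
  · rw [Finset.sum_congr rfl fun j hj => volume_arcIndex_eq (Finset.mem_range.1 (hA hj))]
    rw [Finset.sum_const, nsmul_eq_mul, ← ENNReal.ofReal_natCast,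
      ← ENNReal.ofReal_mul (by positivity)]
    congr 1; ring
  · intro i _ j _ hij
    rw [Function.onFun, Set.disjoint_left]
    rintro x rfl h
    exact hij h
  · intro j _
    exact measurable_arcIndex m (measurableSet_singleton j)

lemma norm_sub_le_of_arcIndex_eq {m : ℕ} (hm : 0 < m) {x y : UnitAddCircle}
    (h : arcIndex m x = arcIndex m y) : ‖x - y‖ ≤ 1 / m := by
  obtain ⟨t, ht, rfl⟩ := exists_coe_eq x
  obtain ⟨s, hs, rfl⟩ := exists_coe_eq y
  have h1 := (arcIndex_eq_iff hm ht _).1 h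
  have h2 := (arcIndex_eq_iff hm hs _).1 rfl
  rw [← AddCircle.coe_sub]
  refine QuotientAddGroup.norm_mk_le_norm.trans ?_
  rw [add_div] at h1 h2
  rw [Real.norm_eq_abs, abs_le]
  constructor <;> linarith [h1.1, h1.2, h2.1, h2.2]

lemma minNorm_le (x : Torus d) (i : Fin d) : minNorm x ≤ ‖x i‖ :=
  ciInf_le (Set.finite_range _).bddBelow i

lemma minNorm_nonneg (x : Torus d) : 0 ≤ minNorm x := Real.iInf_nonneg fun _ => norm_nonneg _

lemma minNorm_le_iff (hd : 0 < d) (x : Torus d) (r : ℝ) : minNorm x ≤ r ↔ ∃ i, ‖x i‖ ≤ r := by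
  have : Nonempty (Fin d) := ⟨⟨0, hd⟩⟩
  constructor
  · intro h
    obtain ⟨i, hi⟩ := exists_eq_ciInf_of_finite (f := fun i => ‖x i‖)
    exact ⟨i, hi.trans_le h⟩
  · rintro ⟨i, hi⟩
    exact (minNorm_le x i).trans hi

lemma minNorm_le_half (hd : 0 < d) (x : Torus d) : minNorm x ≤ 1 / 2 := by
  rw [minNorm_le_iff hd]
  refine ⟨⟨0, hd⟩, ?_⟩
  simpa using AddCircle.norm_le_half_period 1 (x := x ⟨0, hd⟩) one_ne_zero

lemma measurable_minNorm : Measurable (minNorm : Torus d → ℝ) :=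
  Measurable.iInf fun i => (measurable_pi_apply i).norm

lemma measurable_volMin : Measurable (volMin d) := by
  refine Monotone.measurable fun r s h => ?_
  exact measureReal_mono (fun x (hx : minNorm x ≤ r) => hx.trans h) (measure_ne_top _ _)

lemma volMin_nonneg (r : ℝ) : 0 ≤ volMin d r := measureReal_nonneg

lemma volMin_le_one (r : ℝ) : volMin d r ≤ 1 := measureReal_le_one

/-- A point is outside the ball exactly when every coordinate is farther than r from 0, so the
complement is a product of d arcs of length 1 - 2r. -/
lemma volMin_eq (hd : 0 < d) {r : ℝ} (hr : r ∈ Set.Icc (0 : ℝ) (1 / 2)) :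
    volMin d r = 1 - (1 - 2 * r) ^ d := by
  have hms : MeasurableSet {x : Torus d | minNorm x ≤ r} :=
    measurable_minNorm measurableSet_Iic
  have h1 : {x : Torus d | minNorm x ≤ r}ᶜ =
      Set.univ.pi fun _ => (Metric.closedBall (0 : UnitAddCircle) r)ᶜ := by
    ext x
    simp [minNorm_le_iff hd]
  have h2 : volume.real (Metric.closedBall (0 : UnitAddCircle) r)ᶜ = 1 - 2 * r := by
    rw [probReal_compl_eq_one_sub Metric.isClosed_closedBall.measurableSet, measureReal_def,
      AddCircle.volume_closedBall, min_eq_right (by linarith [hr.2]),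
      ENNReal.toReal_ofReal (by linarith [hr.1])]
  have h3 : volume.real {x : Torus d | minNorm x ≤ r}ᶜ = (1 - 2 * r) ^ d := by
    rw [h1, measureReal_def, volume_pi_pi, ENNReal.toReal_prod]
    simp [← measureReal_def, h2]
  rw [probReal_compl_eq_one_sub hms] at h3
  rw [volMin]
  linarith

lemma volMin_le_mul (hd : 0 < d) {r : ℝ} (hr : 0 ≤ r) : volMin d r ≤ 2 * d * r := by
  have hd' : (1 : ℝ) ≤ d := by exact_mod_cast hd
  rcases le_total r (1 / 2) with h | h
  · rw [volMin_eq hd ⟨hr, h⟩]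
    have := one_add_mul_le_pow (a := -(2 * r)) (by linarith) d
    rw [← sub_eq_add_neg] at this
    linarith
  · refine (volMin_le_one r).trans ?_
    nlinarith

lemma volMin_strictMonoOn (hd : 0 < d) : StrictMonoOn (volMin d) (Set.Icc 0 (1 / 2)) := by
  intro r hr s hs h
  rw [volMin_eq hd hr, volMin_eq hd hs]
  have := pow_lt_pow_left₀ (show 1 - 2 * s < 1 - 2 * r by linarith) (by linarith [hs.2]) hd.ne'
  linarith

lemma exists_volMin_eq (hd : 0 < d) {s : ℝ} (hs : s ∈ Set.Icc (0 : ℝ) 1) :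
    ∃ r ∈ Set.Icc (0 : ℝ) (1 / 2), volMin d r = s := by
  have hcont : ContinuousOn (volMin d) (Set.Icc 0 (1 / 2)) := by
    refine ContinuousOn.congr (f := fun r => 1 - (1 - 2 * r) ^ d) (by fun_prop) ?_
    intro r hr
    exact volMin_eq hd hr
  have h := intermediate_value_Icc (by norm_num) hcont
  rw [volMin_eq hd ⟨le_rfl, by norm_num⟩, volMin_eq hd ⟨by norm_num, le_rfl⟩] at h
  have : s ∈ Set.Icc (1 - (1 - 2 * 0) ^ d : ℝ) (1 - (1 - 2 * (1 / 2)) ^ d) := by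
    simpa [hd.ne'] using hs
  exact h this

/-- The volume of the ball around `0` with a uniform point on its boundary is uniform on
`[0, 1]`. -/
lemma map_volMin_minNorm (hd : 0 < d) :
    (volume : Measure (Torus d)).map (fun x => volMin d (minNorm x)) =
      volume.restrict (Set.Ioc 0 1) := by
  have hmeas : Measurable fun x : Torus d => volMin d (minNorm x) :=
    measurable_volMin.comp measurable_minNorm
  have : IsProbabilityMeasure ((volume : Measure (Torus d)).map
    (fun x => volMin d (minNorm x))) := Measure.isProbabilityMeasure_map hmeas.aemeasurable
  -- The distribution functions are compared. For 0 ≤ s < 1, choose r with V_min(r) = s; strict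
  -- monotonicity turns V_min(‖x‖) ≤ s into ‖x‖ ≤ r, an event of probability s.
  refine Measure.ext_of_Iic _ _ fun s => ?_
  rw [Measure.map_apply hmeas measurableSet_Iic, Measure.restrict_apply measurableSet_Iic]
  rcases lt_or_ge s 0 with h0 | h0
  · have h1 : (fun x : Torus d => volMin d (minNorm x)) ⁻¹' Set.Iic s = ∅ := by
      ext x
      simpa using h0.trans_le (volMin_nonneg (minNorm x))
    have h2 : Set.Iic s ∩ Set.Ioc 0 1 = ∅ := by
      ext x
      simp only [Set.mem_inter_iff, Set.mem_Iic, Set.mem_Ioc, Set.mem_empty_iff_false, iff_false]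
      intro h
      linarith [h.1, h.2.1]
    rw [h1, h2]; simp
  rcases le_or_gt 1 s with h1 | h1
  · have h1' : (fun x : Torus d => volMin d (minNorm x)) ⁻¹' Set.Iic s = Set.univ := by
      ext x
      simpa using (volMin_le_one (minNorm x)).trans h1
    have h2 : Set.Iic s ∩ Set.Ioc 0 1 = Set.Ioc 0 1 :=
      Set.inter_eq_right.2 fun x hx => hx.2.trans h1
    rw [h1', h2]; simp
  obtain ⟨r, hr, hrs⟩ := exists_volMin_eq hd ⟨h0, h1.le⟩
  have h1' : (fun x : Torus d => volMin d (minNorm x)) ⁻¹' Set.Iic s = {x | minNorm x ≤ r} := by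
    ext x
    simp only [Set.mem_preimage, Set.mem_Iic, Set.mem_ofPred_eq, ← hrs]
    exact (volMin_strictMonoOn hd).le_iff_le ⟨minNorm_nonneg x, minNorm_le_half hd x⟩ hr
  have h2 : Set.Iic s ∩ Set.Ioc 0 1 = Set.Ioc 0 s := by
    ext x
    simp only [Set.mem_inter_iff, Set.mem_Iic, Set.mem_Ioc]
    constructor
    · rintro ⟨h, h', _⟩; exact ⟨h', h⟩
    · rintro ⟨h, h'⟩; exact ⟨h', h, h'.trans h1.le⟩
  rw [h1', h2, Real.volume_Ioc, sub_zero, ← hrs, volMin, measureReal_def,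
    ENNReal.ofReal_toReal (measure_ne_top _ _)]

/-- By translation invariance the centre x is irrelevant. This reduces every average over a position
to an integral over a uniform variable on (0, 1]. -/
lemma lintegral_volMin_minNorm_sub (hd : 0 < d) {f : ℝ → ENNReal} (hf : Measurable f)
    (x : Torus d) :
    ∫⁻ y : Torus d, f (volMin d (minNorm (x - y))) = ∫⁻ s in Set.Ioc 0 1, f s := by
  have hmeas : Measurable fun x : Torus d => volMin d (minNorm x) :=
    measurable_volMin.comp measurable_minNorm
  rw [← map_volMin_minNorm hd, lintegral_map hf hmeas]
  have h : ∀ y, minNorm (x - y) = minNorm (y - x) := fun y => by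
    simp only [minNorm, Pi.sub_apply, norm_sub_rev]
  simp_rw [h]
  exact lintegral_sub_right_eq_self (fun y => f (volMin d (minNorm y))) x

lemma ae_volMin_minNorm_sub_pos (hd : 0 < d) (x : Torus d) :
    ∀ᵐ y : Torus d, 0 < volMin d (minNorm (x - y)) := by
  have h := lintegral_volMin_minNorm_sub hd
    (f := (Set.Iic (0 : ℝ)).indicator 1) (measurable_one.indicator measurableSet_Iic) x
  have h0 : ∫⁻ s in Set.Ioc (0 : ℝ) 1, (Set.Iic (0 : ℝ)).indicator (1 : ℝ → ENNReal) s = 0 := by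
    rw [setLIntegral_congr_fun (g := 0) measurableSet_Ioc]
    · simp
    · intro s hs
      simp [hs.1]
  have hms : Measurable fun y : Torus d => volMin d (minNorm (x - y)) :=
    measurable_volMin.comp (measurable_minNorm.comp (by fun_prop))
  have hms' : Measurable fun y : Torus d =>
      (Set.Iic (0 : ℝ)).indicator (1 : ℝ → ENNReal) (volMin d (minNorm (x - y))) :=
    (measurable_one.indicator measurableSet_Iic).comp hms
  rw [h0, lintegral_eq_zero_iff hms'] at h
  filter_upwards [h] with y hy
  by_contra hcon
  have : volMin d (minNorm (x - y)) ∈ Set.Iic (0 : ℝ) := not_lt.1 hcon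
  simp [Set.indicator_of_mem this] at hy

lemma minNorm_ne_zero_of_volMin_pos (hd : 0 < d) {x : Torus d} (h : 0 < volMin d (minNorm x)) :
    minNorm x ≠ 0 := by
  intro h0
  rw [h0, volMin_eq hd ⟨le_rfl, by norm_num⟩] at h
  simp at h

lemma minNorm_sub_le_of_arcIndex_eq {m : ℕ} (hm : 0 < m) {x y : Torus d} {i : Fin d}
    (h : arcIndex m (x i) = arcIndex m (y i)) : minNorm (x - y) ≤ 1 / m :=
  (minNorm_le _ i).trans (norm_sub_le_of_arcIndex_eq hm h)

end TorusGeometry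

/-! ### Tails, window masses and mean of a power law -/

section PowerLaw

variable {τ : ℝ} {D : Measure ℝ}

lemma setLIntegral_Ici_rpow {t : ℝ} (hτ : 1 < τ) (ht : 0 < t) {C : ℝ} (hC : 0 ≤ C) :
    ∫⁻ x in Set.Ici t, ENNReal.ofReal (C * x ^ (-τ)) =
      ENNReal.ofReal (C / (τ - 1) * t ^ (1 - τ)) := by
  have hint := (integrableOn_Ioi_rpow_of_lt (by linarith : -τ < -1) ht).const_mul C
  rw [setLIntegral_congr Ioi_ae_eq_Ici.symm, ← ofReal_integral_eq_lintegral_ofReal hint]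
  · rw [integral_const_mul, integral_Ioi_rpow_of_lt (by linarith) ht]
    congr 1
    rw [show -τ + 1 = -(τ - 1) by ring, show 1 - τ = -(τ - 1) by ring]
    have : τ - 1 ≠ 0 := by linarith
    field_simp
  · refine (ae_restrict_iff' measurableSet_Ioi).2 (Eventually.of_forall fun x hx => ?_)
    have : 0 < x := ht.trans hx
    positivity

lemma IsDiscretePowerLaw.measure_Ici_le (h : IsDiscretePowerLaw τ D) (hτ : 1 < τ) :
    ∃ C : ℝ, 0 < C ∧ ∀ t : ℝ, 1 ≤ t → D (Set.Ici t) ≤ ENNReal.ofReal (C * t ^ (1 - τ)) := by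
  obtain ⟨h0, c, C, hc, hC, hD⟩ := h
  have hτ1 : 0 < τ - 1 := by linarith
  refine ⟨C * 2 ^ τ / (τ - 1), by positivity, fun t ht => ?_⟩
  have hsingle : ∀ k : ℕ, t ≤ k → D {(k : ℝ)} ≤
      ∫⁻ x in Set.Ico (k : ℝ) (k + 1), ENNReal.ofReal (C * 2 ^ τ * x ^ (-τ)) := by
    intro k hk
    have hk1 : (1 : ℝ) ≤ k := ht.trans hk
    have hfin : D {(k : ℝ)} ≠ ⊤ := by
      intro htop
      have := (hD k (by exact_mod_cast hk1)).1
      rw [measureReal_def, htop] at this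
      have hpos : 0 < c * (k : ℝ) ^ (-τ) := by positivity
      simp only [ENNReal.toReal_top] at this
      linarith
    calc D {(k : ℝ)} ≤ ENNReal.ofReal (C * (k : ℝ) ^ (-τ)) := by
          rw [← ENNReal.ofReal_toReal hfin]
          exact ENNReal.ofReal_le_ofReal (hD k (by exact_mod_cast hk1)).2
      _ = ∫⁻ x in Set.Ico (k : ℝ) (k + 1), ENNReal.ofReal (C * (k : ℝ) ^ (-τ)) := by simp
      _ ≤ _ := by
          refine setLIntegral_mono' measurableSet_Ico fun x hx => ENNReal.ofReal_le_ofReal ?_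
          have hxpos : 0 < x := by linarith [hx.1]
          -- On [k, k + 1) one has x ≤ 2k, so replacing k by x in the density costs at most 2^τ.
          -- Each atom is thereby dominated by an integral over its own unit interval.
          have : (2 * (k : ℝ)) ^ (-τ) ≤ x ^ (-τ) :=
            Real.rpow_le_rpow_of_nonpos hxpos (by linarith [hx.2]) (by linarith)
          rw [Real.mul_rpow (by norm_num) (by linarith), Real.rpow_neg (by norm_num)] at this
          have h2 : (0 : ℝ) < 2 ^ τ := by positivity
          calc C * (k : ℝ) ^ (-τ) = C * 2 ^ τ * ((2 ^ τ)⁻¹ * (k : ℝ) ^ (-τ)) := by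
                field_simp
            _ ≤ _ := by gcongr
  have hcover : D (Set.Ici t) ≤ D (⋃ k ∈ {k : ℕ | t ≤ k}, {(k : ℝ)}) := by
    calc D (Set.Ici t) ≤ D ((⋃ k ∈ {k : ℕ | t ≤ k}, {(k : ℝ)}) ∪
          (Set.range (fun k : ℕ => (k : ℝ)))ᶜ) := by
          refine measure_mono fun x hx => ?_
          by_cases hx' : x ∈ Set.range (fun k : ℕ => (k : ℝ))
          · obtain ⟨k, rfl⟩ := hx'
            left
            simpa using hx
          · exact Or.inr hx'
      _ ≤ _ := (measure_union_le _ _).trans (by rw [h0, add_zero])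
  calc D (Set.Ici t) ≤ ∑' k : {k : ℕ | t ≤ k}, D {((k : ℕ) : ℝ)} :=
        hcover.trans (measure_biUnion_le _ (Set.to_countable _) _)
    _ ≤ ∑' k : {k : ℕ | t ≤ k}, ∫⁻ x in Set.Ico ((k : ℕ) : ℝ) ((k : ℕ) + 1),
          ENNReal.ofReal (C * 2 ^ τ * x ^ (-τ)) :=
        ENNReal.tsum_le_tsum fun k => hsingle k k.2
    _ = ∫⁻ x in ⋃ k : {k : ℕ | t ≤ k}, Set.Ico ((k : ℕ) : ℝ) ((k : ℕ) + 1),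
          ENNReal.ofReal (C * 2 ^ τ * x ^ (-τ)) := by
        rw [lintegral_iUnion (fun _ => measurableSet_Ico)]
        intro i j hij
        rw [Function.onFun, Set.disjoint_left]
        rintro x ⟨h1, h2⟩ ⟨h3, h4⟩
        refine hij (Subtype.ext ?_)
        have h5 : ((i : ℕ) : ℝ) < (j : ℕ) + 1 := h1.trans_lt h4
        have h6 : ((j : ℕ) : ℝ) < (i : ℕ) + 1 := h3.trans_lt h2
        norm_cast at h5 h6
        omega
    _ ≤ ∫⁻ x in Set.Ici t, ENNReal.ofReal (C * 2 ^ τ * x ^ (-τ)) :=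
        lintegral_mono_set (Set.iUnion_subset fun k x hx => (show t ≤ _ from k.2).trans hx.1)
    _ = _ := setLIntegral_Ici_rpow hτ (by linarith) (by positivity)

lemma IsContinuousPowerLaw.measure_Ici_le (h : IsContinuousPowerLaw τ D) (hτ : 1 < τ) :
    ∃ C : ℝ, 0 < C ∧ ∀ t : ℝ, 1 ≤ t → D (Set.Ici t) ≤ ENNReal.ofReal (C * t ^ (1 - τ)) := by
  obtain ⟨f, hf, hf0, rfl, c, C, hc, hC, hfC⟩ := h
  refine ⟨C / (τ - 1), div_pos hC (by linarith), fun t ht => ?_⟩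
  rw [withDensity_apply _ measurableSet_Ici, ← setLIntegral_Ici_rpow hτ (by linarith) hC.le]
  exact setLIntegral_mono' measurableSet_Ici fun x hx =>
    ENNReal.ofReal_le_ofReal (hfC x (ht.trans hx)).2

lemma IsPowerLaw.measure_Ici_le (h : IsPowerLaw τ D) (hτ : 1 < τ) :
    ∃ C : ℝ, 0 < C ∧ ∀ t : ℝ, 1 ≤ t → D (Set.Ici t) ≤ ENNReal.ofReal (C * t ^ (1 - τ)) :=
  h.2.2.elim (fun h => h.measure_Ici_le hτ) fun h => h.measure_Ici_le hτ

lemma IsDiscretePowerLaw.le_measure_Icc [IsFiniteMeasure D] (h : IsDiscretePowerLaw τ D)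
    (hτ : 0 ≤ τ) {a b : ℝ} (ha : 0 < a) (hab : a < b) :
    ∃ c : ℝ, 0 < c ∧ ∀ᶠ t : ℝ in atTop,
      ENNReal.ofReal (c * t ^ (1 - τ)) ≤ D (Set.Icc (a * t) (b * t)) := by
  obtain ⟨-, c, C, hc, hC, hD⟩ := h
  have hb : 0 < b := ha.trans hab
  refine ⟨(b - a) / 2 * c * b ^ (-τ), by
    have : 0 < b - a := by linarith
    positivity, ?_⟩
  -- The first threshold puts the interval inside [1, ∞). The second makes its length at least 2, so
  -- rounding the endpoints loses at most half of the length in counting integers.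
  filter_upwards [eventually_ge_atTop (1 / a), eventually_ge_atTop (2 / (b - a))] with t h1 h2
  have ht : 0 < t := lt_of_lt_of_le (by positivity) h1
  rw [div_le_iff₀ (by linarith)] at h1 h2
  have hat : 1 ≤ a * t := by linarith
  set I := Finset.Icc ⌈a * t⌉₊ ⌊b * t⌋₊ with hI
  have hcard : (b - a) / 2 * t ≤ (I.card : ℝ) := by
    rw [hI, Nat.card_Icc]
    have h3 := Nat.ceil_lt_add_one (mul_pos ha ht).le
    have h4 := Nat.lt_floor_add_one (b * t)
    have h5 : ((⌊b * t⌋₊ + 1 : ℕ) : ℝ) - (⌈a * t⌉₊ : ℕ) ≤ ((⌊b * t⌋₊ + 1 - ⌈a * t⌉₊ : ℕ) : ℝ) := by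
      rw [sub_le_iff_le_add]
      norm_cast
      omega
    push_cast at h5
    refine le_trans ?_ h5
    linarith
  have hsub : ((I.image fun k : ℕ => (k : ℝ)) : Set ℝ) ⊆ Set.Icc (a * t) (b * t) := by
    intro x hx
    simp only [Finset.coe_image, Set.mem_image, Finset.mem_coe, hI, Finset.mem_Icc] at hx
    obtain ⟨k, ⟨hk1, hk2⟩, rfl⟩ := hx
    exact ⟨Nat.ceil_le.1 hk1, (Nat.le_floor_iff (by positivity)).1 hk2⟩
  have hterm : ∀ k ∈ I, c * (b * t) ^ (-τ) ≤ D.real {(k : ℝ)} := by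
    intro k hk
    have hk' : (k : ℝ) ∈ Set.Icc (a * t) (b * t) := hsub (by
      simp only [Finset.coe_image]; exact ⟨k, hk, rfl⟩)
    have hk1 : 1 ≤ (k : ℝ) := hat.trans hk'.1
    refine le_trans ?_ (hD k (by exact_mod_cast hk1)).1
    gcongr c * ?_
    exact Real.rpow_le_rpow_of_nonpos (by linarith) hk'.2 (by linarith)
  have hreal : (b - a) / 2 * c * b ^ (-τ) * t ^ (1 - τ) ≤ D.real (Set.Icc (a * t) (b * t)) := by
    calc (b - a) / 2 * c * b ^ (-τ) * t ^ (1 - τ)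
        = (b - a) / 2 * t * (c * (b * t) ^ (-τ)) := by
          rw [Real.mul_rpow hb.le ht.le, sub_eq_add_neg 1, Real.rpow_add ht, Real.rpow_one]; ring
      _ ≤ I.card * (c * (b * t) ^ (-τ)) := by gcongr
      _ = ∑ k ∈ I, c * (b * t) ^ (-τ) := by simp
      _ ≤ ∑ k ∈ I, D.real {(k : ℝ)} := Finset.sum_le_sum hterm
      _ = ∑ x ∈ I.image fun k : ℕ => (k : ℝ), D.real {x} := by
          rw [Finset.sum_image]; exact fun x _ y _ h => Nat.cast_injective h
      _ = D.real (I.image fun k : ℕ => (k : ℝ)) := sum_measureReal_singleton _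
      _ ≤ _ := measureReal_mono hsub
  exact ENNReal.ofReal_le_of_le_toReal hreal

lemma IsContinuousPowerLaw.le_measure_Icc (h : IsContinuousPowerLaw τ D)
    (hτ : 0 ≤ τ) {a b : ℝ} (ha : 0 < a) (hab : a < b) :
    ∃ c : ℝ, 0 < c ∧ ∀ᶠ t : ℝ in atTop,
      ENNReal.ofReal (c * t ^ (1 - τ)) ≤ D (Set.Icc (a * t) (b * t)) := by
  obtain ⟨f, hf, hf0, rfl, c, C, hc, hC, hfC⟩ := h
  have hb : 0 < b := ha.trans hab
  have hba : 0 < b - a := by linarith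
  refine ⟨(b - a) * c * b ^ (-τ), by positivity, ?_⟩
  filter_upwards [eventually_ge_atTop (1 / a)] with t h1
  have ht : 0 < t := lt_of_lt_of_le (by positivity) h1
  rw [div_le_iff₀ ha] at h1
  rw [withDensity_apply _ measurableSet_Icc]
  calc ENNReal.ofReal ((b - a) * c * b ^ (-τ) * t ^ (1 - τ))
      = ENNReal.ofReal (c * (b * t) ^ (-τ)) * volume (Set.Icc (a * t) (b * t)) := by
        rw [Real.volume_Icc, ← ENNReal.ofReal_mul (by positivity)]
        congr 1
        rw [Real.mul_rpow hb.le ht.le, sub_eq_add_neg 1, Real.rpow_add ht, Real.rpow_one]; ring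
    _ = ∫⁻ x in Set.Icc (a * t) (b * t), ENNReal.ofReal (c * (b * t) ^ (-τ)) := by simp
    _ ≤ _ := by
        refine setLIntegral_mono' measurableSet_Icc fun x hx => ENNReal.ofReal_le_ofReal ?_
        have hx1 : 1 ≤ x := by linarith [hx.1]
        refine le_trans ?_ (hfC x hx1).1
        gcongr c * ?_
        exact Real.rpow_le_rpow_of_nonpos (by linarith) hx.2 (by linarith)

lemma IsPowerLaw.le_measure_Icc (h : IsPowerLaw τ D)
    (hτ : 0 ≤ τ) {a b : ℝ} (ha : 0 < a) (hab : a < b) :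
    ∃ c : ℝ, 0 < c ∧ ∀ᶠ t : ℝ in atTop,
      ENNReal.ofReal (c * t ^ (1 - τ)) ≤ D (Set.Icc (a * t) (b * t)) := by
  have := h.1
  exact h.2.2.elim (fun h => h.le_measure_Icc hτ ha hab) fun h => h.le_measure_Icc hτ ha hab

lemma IsPowerLaw.ae_one_le (h : IsPowerLaw τ D) : ∀ᵐ w ∂D, 1 ≤ w := h.2.1

/-- The mean is the integral of the tail, which is at most 1 on (0, 1] and of order t^(1-τ) beyond;
τ > 2 makes this integrable. -/
lemma IsPowerLaw.lintegral_lt_top (h : IsPowerLaw τ D) (hτ : 2 < τ) :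
    ∫⁻ w, ENNReal.ofReal w ∂D < ⊤ := by
  have := h.1
  obtain ⟨C, hC, hD⟩ := h.measure_Ici_le (by linarith)
  rw [lintegral_eq_lintegral_meas_le D (h.ae_one_le.mono fun w hw => zero_le_one.trans hw)
    aemeasurable_id, ← Set.Ioc_union_Ioi_eq_Ioi zero_le_one,
    lintegral_union measurableSet_Ioi (Set.Ioc_disjoint_Ioi le_rfl)]
  refine ENNReal.add_lt_top.2 ⟨?_, ?_⟩
  · calc ∫⁻ t in Set.Ioc (0 : ℝ) 1, D {a | t ≤ id a} ≤ ∫⁻ t in Set.Ioc (0 : ℝ) 1, 1 :=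
          lintegral_mono fun t => prob_le_one
      _ < ⊤ := by simp
  · calc ∫⁻ t in Set.Ioi (1 : ℝ), D {a | t ≤ id a}
        ≤ ∫⁻ t in Set.Ioi (1 : ℝ), ENNReal.ofReal (C * t ^ (-(τ - 1))) := by
          refine setLIntegral_mono' measurableSet_Ioi fun t ht => ?_
          rw [neg_sub]
          exact hD t (le_of_lt ht)
      _ = _ := by
          rw [setLIntegral_congr Ioi_ae_eq_Ici,
            setLIntegral_Ici_rpow (by linarith) zero_lt_one hC.le]
      _ < ⊤ := ENNReal.ofReal_lt_top

end PowerLaw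

/-! ### Chernoff bounds for thinned neighbourhoods and vertex counts -/

section Concentration

/-- The map g selects distinct coordinates of a product space. It is used with u ↦ s(u, v), whose
injectivity makes the edge decisions at v independent. -/
lemma lintegral_prod_pi_precomp {ι κ Ω : Type*} [Fintype κ] [MeasurableSpace Ω]
    (μ : Measure Ω) [IsProbabilityMeasure μ] (s : Finset ι) {g : ι → κ}
    (hg : Function.Injective g) {H : ι → Ω → ENNReal} (hH : ∀ i, Measurable (H i)) :
    ∫⁻ U : κ → Ω, ∏ i ∈ s, H i (U (g i)) ∂(Measure.pi fun _ => μ) =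
      ∏ i ∈ s, ∫⁻ x, H i x ∂μ := by
  have h1 : ProbabilityTheory.iIndepFun (fun (i : ι) (U : κ → Ω) => U (g i))
      (Measure.pi fun _ => μ) :=
    (ProbabilityTheory.iIndepFun_pi (μ := fun _ : κ => μ) (X := fun _ => id)
      fun _ => aemeasurable_id).precomp hg
  have h2 := h1.comp H hH
  rw [ProbabilityTheory.lintegral_prod_eq_prod_lintegral_of_indepFun s
    (fun i (U : κ → Ω) => H i (U (g i))) h2 fun i => (hH i).comp (measurable_pi_apply _)]
  refine Finset.prod_congr rfl fun i _ => ?_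
  exact (measurePreserving_eval (fun _ : κ => μ) (g i)).lintegral_comp (hH i)

/-- Given the mark of v, the other marks are still i.i.d., so the product factorises after
conditioning on that mark. -/
lemma lintegral_prod_erase_pi {Ω : Type*} [MeasurableSpace Ω]
    (μ : Measure Ω) [IsProbabilityMeasure μ] {n : ℕ} (v : Fin n) {f : Ω → ENNReal}
    (hf : Measurable f) {G : Fin n → Ω → Ω → ENNReal}
    (hG : ∀ u, Measurable (Function.uncurry (G u))) :
    ∫⁻ z : Fin n → Ω, f (z v) * ∏ u ∈ Finset.univ.erase v, G u (z v) (z u)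
        ∂(Measure.pi fun _ => μ) =
      ∫⁻ z, f z * ∏ u ∈ Finset.univ.erase v, ∫⁻ z', G u z z' ∂μ ∂μ := by
  obtain _ | k := n
  · exact v.elim0
  have herase : Finset.univ.erase v = Finset.univ.map (Fin.succAboveEmb v) := by
    ext u
    simp [Fin.exists_succAbove_eq_iff]
  have hmeas : ∀ u, Measurable fun p : Ω × (Fin k → Ω) =>
      G (v.succAbove u) p.1 (p.2 u) := fun u =>
    (hG _).comp (measurable_fst.prodMk ((measurable_pi_apply u).comp measurable_snd))
  simp_rw [herase, Finset.prod_map, Fin.coe_succAboveEmb]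
  have hF : Measurable fun p : Ω × (Fin k → Ω) =>
      f p.1 * ∏ u, G (v.succAbove u) p.1 (p.2 u) :=
    (hf.comp measurable_fst).mul (Finset.measurable_prod _ fun u _ => hmeas u)
  have h := (measurePreserving_piFinSuccAbove (fun _ : Fin (k + 1) => μ) v).lintegral_comp hF
  simp only [MeasurableEquiv.piFinSuccAbove_apply] at h
  refine h.trans ?_
  rw [lintegral_prod _ hF.aemeasurable]
  refine lintegral_congr fun z => ?_
  have hsec : ∀ u : Fin k, Measurable (G (v.succAbove u) z) := fun u =>
    (hG _).comp measurable_prodMk_left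
  have hsecs : Measurable fun y : Fin k → Ω => ∏ u, G (v.succAbove u) z (y u) :=
    Finset.measurable_prod _ fun u _ => (hsec u).comp (measurable_pi_apply u)
  refine (lintegral_const_mul (f z) hsecs).trans ?_
  congr 1
  exact lintegral_prod_pi_precomp μ Finset.univ Function.injective_id hsec

variable {d : ℕ} {τ α : ℝ}

namespace MCDGIRG

instance isProbabilityMeasure_weightLaw (M : MCDGIRG d τ α) :
    IsProbabilityMeasure M.weightLaw := M.isPowerLaw.1

/-- The joint law of the weight and the position of a vertex. -/
noncomputable def vertexLaw (M : MCDGIRG d τ α) : Measure (ℝ × Torus d) :=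
  M.weightLaw.prod volume

instance isProbabilityMeasure_vertexLaw (M : MCDGIRG d τ α) :
    IsProbabilityMeasure M.vertexLaw := by
  unfold vertexLaw; infer_instance

/-- The weight and the position of a vertex. -/
def mark {n : ℕ} (ω : Sample d n) (v : Fin n) : ℝ × Torus d := (ω.1 v, ω.2.1 v)

lemma measurable_mark {n : ℕ} (v : Fin n) :
    Measurable fun ω : Sample d n => mark ω v := by
  unfold mark; fun_prop

instance isProbabilityMeasure_positions (d n : ℕ) :
    IsProbabilityMeasure (volume : Measure (Fin n → Torus d)) :=
  inferInstanceAs (IsProbabilityMeasure (Measure.pi fun _ : Fin n => (volume : Measure (Torus d))))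

instance isProbabilityMeasure_auxiliary (n : ℕ) :
    IsProbabilityMeasure (volume : Measure (Sym2 (Fin n) → unitInterval)) :=
  inferInstanceAs (IsProbabilityMeasure
    (Measure.pi fun _ : Sym2 (Fin n) => (volume : Measure unitInterval)))

instance isProbabilityMeasure_law (M : MCDGIRG d τ α) (n : ℕ) :
    IsProbabilityMeasure (M.law n) := by
  unfold law; infer_instance

/-- Weights and positions are regrouped into i.i.d. marks, one per vertex, with the auxiliary
numbers integrated innermost. -/
lemma lintegral_law (M : MCDGIRG d τ α) (n : ℕ) {F : Sample d n → ENNReal} (hF : Measurable F) :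
    ∫⁻ ω, F ω ∂M.law n =
      ∫⁻ z : Fin n → ℝ × Torus d, (∫⁻ U : Sym2 (Fin n) → unitInterval,
        F (fun v => (z v).1, fun v => (z v).2, U)) ∂(Measure.pi fun _ => M.vertexLaw) := by
  have h := (measurePreserving_arrowProdEquivProdArrow ℝ (Torus d) (Fin n)
    (fun _ => M.weightLaw) (fun _ => volume)).lintegral_comp
    (f := fun p => ∫⁻ U : Sym2 (Fin n) → unitInterval, F (p.1, p.2, U))
    (Measurable.lintegral_prod_right'
      (f := fun q : ((Fin n → ℝ) × (Fin n → Torus d)) × (Sym2 (Fin n) → unitInterval) =>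
        F (q.1.1, q.1.2, q.2)) (hF.comp (by fun_prop)))
  refine Eq.trans ?_ h.symm
  rw [law, lintegral_prod _ hF.aemeasurable, lintegral_prod]
  · refine lintegral_congr fun w => ?_
    rw [lintegral_prod]
    · rfl
    · exact (hF.comp (by fun_prop)).aemeasurable
  · exact (Measurable.lintegral_prod_right'
      (f := fun q : ((Fin n → ℝ) × (Fin n → Torus d)) × (Sym2 (Fin n) → unitInterval) =>
        F (q.1.1, q.1.2, q.2)) (hF.comp (by fun_prop))).aemeasurable

/-- The vertices `u ≠ v` whose auxiliary number for the pair `uv` is below `p u`, as a function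
of the marks of `u` and `v`. -/
noncomputable def thinnedNbhd {n : ℕ} (v : Fin n)
    (p : Fin n → ℝ × Torus d → ℝ × Torus d → ℝ) (ω : Sample d n) : Finset (Fin n) :=
  {u ∈ Finset.univ.erase v | (ω.2.2 s(u, v) : ℝ) < p u (mark ω v) (mark ω u)}

lemma mem_thinnedNbhd {n : ℕ} {u v : Fin n} {p : Fin n → ℝ × Torus d → ℝ × Torus d → ℝ}
    {ω : Sample d n} : u ∈ thinnedNbhd v p ω ↔
      u ≠ v ∧ (ω.2.2 s(u, v) : ℝ) < p u (mark ω v) (mark ω u) := by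
  simp [thinnedNbhd]

lemma lintegral_ite_lt {p s : ℝ} (hp : p ∈ Set.Icc (0 : ℝ) 1) :
    ∫⁻ x : unitInterval, ENNReal.ofReal (Real.exp (if (x : ℝ) < p then s else 0)) =
      ENNReal.ofReal (1 + (Real.exp s - 1) * p) := by
  have hms : MeasurableSet (Set.Iio (⟨p, hp⟩ : unitInterval)) := measurableSet_Iio
  have h : ∀ x : unitInterval, ENNReal.ofReal (Real.exp (if (x : ℝ) < p then s else 0)) =
      (Set.Iio (⟨p, hp⟩ : unitInterval)).indicator (fun _ => ENNReal.ofReal (Real.exp s)) x +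
      (Set.Iio (⟨p, hp⟩ : unitInterval))ᶜ.indicator (fun _ => 1) x := by
    intro x
    by_cases hx : (x : ℝ) < p
    · have h1 : x ∈ Set.Iio (⟨p, hp⟩ : unitInterval) := hx
      rw [Set.indicator_of_mem h1, Set.indicator_of_notMem (Set.notMem_compl_iff.2 h1)]
      simp [hx]
    · have h1 : x ∉ Set.Iio (⟨p, hp⟩ : unitInterval) := hx
      rw [Set.indicator_of_notMem h1, Set.indicator_of_mem (Set.mem_compl h1)]
      simp [hx]
  simp_rw [h]
  rw [lintegral_add_left (measurable_const.indicator hms), lintegral_indicator_const hms,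
    lintegral_indicator_const hms.compl, prob_compl_eq_one_sub hms, unitInterval.volume_Iio, one_mul,
    ← ENNReal.ofReal_mul (Real.exp_pos s).le, ← ENNReal.ofReal_one,
    ← ENNReal.ofReal_sub _ hp.1, ← ENNReal.ofReal_add (mul_nonneg (Real.exp_pos s).le hp.1)
      (by simpa using hp.2)]
  congr 1
  ring

lemma card_filter_exp {ι : Type*} (s : ℝ) (I : Finset ι) (P : ι → Prop) [DecidablePred P] :
    ENNReal.ofReal (Real.exp (s * (I.filter P).card)) =
      ∏ u ∈ I, ENNReal.ofReal (Real.exp (if P u then s else 0)) := by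
  rw [← ENNReal.ofReal_prod_of_nonneg fun _ _ => (Real.exp_pos _).le, ← Real.exp_sum,
    ← Finset.sum_filter]
  simp [mul_comm]

/-- Chernoff's bound for the number of thinned neighbours of a vertex with mark in `Z`. With
`s > 0` it bounds the upper tail, with `s < 0` the lower tail. -/
lemma law_thinnedNbhd_le (M : MCDGIRG d τ α) {n : ℕ} (v : Fin n)
    {p : Fin n → ℝ × Torus d → ℝ × Torus d → ℝ}
    (hp : ∀ u, Measurable (Function.uncurry (p u)))
    (hp01 : ∀ u z z', p u z z' ∈ Set.Icc (0 : ℝ) 1)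
    {Z : Set (ℝ × Torus d)} (hZ : MeasurableSet Z) {s B : ℝ}
    (hB : ∀ z ∈ Z, (Real.exp s - 1) *
      ∑ u ∈ Finset.univ.erase v, ∫ z', p u z z' ∂M.vertexLaw ≤ B) (T : ℝ) :
    M.law n {ω | mark ω v ∈ Z ∧ s * T ≤ s * (thinnedNbhd v p ω).card} ≤
      ENNReal.ofReal (Real.exp (B - s * T)) := by
  set F : Sample d n → ENNReal := fun ω => Z.indicator 1 (mark ω v) *
    ∏ u ∈ Finset.univ.erase v, ENNReal.ofReal (Real.exp
      (if (ω.2.2 s(u, v) : ℝ) < p u (mark ω v) (mark ω u) then s else 0)) with hFdef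
  have hfac : ∀ u, Measurable fun ω : Sample d n => ENNReal.ofReal (Real.exp
      (if (ω.2.2 s(u, v) : ℝ) < p u (mark ω v) (mark ω u) then s else 0)) := by
    intro u
    refine (Real.measurable_exp.comp (Measurable.ite ?_ measurable_const
      measurable_const)).ennreal_ofReal
    refine measurableSet_lt (by fun_prop) ?_
    exact (hp u).comp ((measurable_mark v).prodMk (measurable_mark u))
  have hF : Measurable F :=
    ((measurable_one.indicator hZ).comp (measurable_mark v)).mul
      (Finset.measurable_prod _ fun u _ => hfac u)
  have hsub : {ω | mark ω v ∈ Z ∧ s * T ≤ s * (thinnedNbhd v p ω).card} ⊆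
      {ω | ENNReal.ofReal (Real.exp (s * T)) ≤ F ω} := by
    rintro ω ⟨h1, h2⟩
    simp only [hFdef, Set.mem_ofPred_eq, Set.indicator_of_mem h1, Pi.one_apply, one_mul]
    rw [← card_filter_exp]
    exact ENNReal.ofReal_le_ofReal (Real.exp_le_exp.2 h2)
  have hint : ∫⁻ ω, F ω ∂M.law n ≤ ENNReal.ofReal (Real.exp B) := by
    rw [M.lintegral_law n hF]
    have hU : ∀ z : Fin n → ℝ × Torus d, ∫⁻ U : Sym2 (Fin n) → unitInterval,
        F (fun v => (z v).1, fun v => (z v).2, U) =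
        Z.indicator 1 (z v) * ∏ u ∈ Finset.univ.erase v,
          ENNReal.ofReal (1 + (Real.exp s - 1) * p u (z v) (z u)) := by
      intro z
      have hg : Function.Injective fun u : Fin n => s(u, v) := fun a b h =>
        Sym2.congr_left.1 h
      have hH : ∀ u : Fin n, Measurable fun x : unitInterval => ENNReal.ofReal (Real.exp
          (if (x : ℝ) < p u (z v) (z u) then s else 0)) := fun u =>
        (Real.measurable_exp.comp (Measurable.ite (measurableSet_lt (by fun_prop) (by fun_prop))
          measurable_const measurable_const)).ennreal_ofReal
      have hprod := lintegral_prod_pi_precomp (volume : Measure unitInterval)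
        (Finset.univ.erase v) hg hH
      simp_rw [lintegral_ite_lt (hp01 _ _ _)] at hprod
      rw [← hprod]
      have hHs : Measurable fun U : Sym2 (Fin n) → unitInterval =>
          ∏ u ∈ Finset.univ.erase v, ENNReal.ofReal (Real.exp
            (if (U s(u, v) : ℝ) < p u (z v) (z u) then s else 0)) :=
        Finset.measurable_prod _ fun u _ => (hH u).comp (measurable_pi_apply s(u, v))
      exact lintegral_const_mul (Z.indicator 1 (z v)) hHs
    simp_rw [hU]
    rw [lintegral_prod_erase_pi M.vertexLaw v (f := Z.indicator 1)
      (G := fun u z z' => ENNReal.ofReal (1 + (Real.exp s - 1) * p u z z'))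
      (measurable_one.indicator hZ)
      (fun u => (((hp u).const_mul (Real.exp s - 1)).const_add 1).ennreal_ofReal)]
    calc _ ≤ ∫⁻ z, ENNReal.ofReal (Real.exp B) ∂M.vertexLaw := by
          refine lintegral_mono fun z => ?_
          by_cases hz : z ∈ Z
          · simp only [Set.indicator_of_mem hz, Pi.one_apply, one_mul]
            have hint : ∀ u, Integrable (fun z' => p u z z') M.vertexLaw := fun u =>
              Integrable.of_mem_Icc 0 1 ((hp u).comp measurable_prodMk_left).aemeasurable
                (Eventually.of_forall fun z' => hp01 u z z')
            -- The Bernoulli moment generating function 1 + (e^s - 1)p is averaged over the other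
            -- mark, and 1 + x ≤ e^x applies for either sign of s. Nonnegativity of the integrand
            -- for s < 0 comes from p ≤ 1.
            have hfactor : ∀ u, ∫⁻ z', ENNReal.ofReal (1 + (Real.exp s - 1) * p u z z')
                ∂M.vertexLaw ≤
                ENNReal.ofReal (Real.exp ((Real.exp s - 1) * ∫ z', p u z z' ∂M.vertexLaw)) := by
              intro u
              have hint' : Integrable (fun z' => 1 + (Real.exp s - 1) * p u z z') M.vertexLaw :=
                (integrable_const _).add ((hint u).const_mul _)
              rw [← ofReal_integral_eq_lintegral_ofReal hint']
              · refine ENNReal.ofReal_le_ofReal ?_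
                rw [integral_add (integrable_const _) ((hint u).const_mul _),
                  integral_const_mul]
                simp only [integral_const, probReal_univ, smul_eq_mul, mul_one]
                rw [add_comm]
                exact Real.add_one_le_exp _
              · refine Eventually.of_forall fun z' => ?_
                have h1 := hp01 u z z'
                have h2 := Real.exp_pos s
                simp only [Pi.zero_apply]
                nlinarith [h1.1, h1.2, mul_nonneg h2.le h1.1]
            refine (Finset.prod_le_prod' fun u _ => hfactor u).trans ?_
            rw [← ENNReal.ofReal_prod_of_nonneg fun _ _ => (Real.exp_pos _).le, ← Real.exp_sum,
              ← Finset.mul_sum]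
            exact ENNReal.ofReal_le_ofReal (Real.exp_le_exp.2 (hB z hz))
          · simp [Set.indicator_of_notMem hz]
      _ = _ := by simp
  -- Markov's inequality for the exponential moment, which needs no measurability of the event
  -- itself beyond that of `F`.
  have hmarkov := (mul_meas_ge_le_lintegral (μ := M.law n) hF
    (ENNReal.ofReal (Real.exp (s * T)))).trans hint
  refine (measure_mono hsub).trans ?_
  rw [Real.exp_sub, ENNReal.ofReal_div_of_pos (Real.exp_pos _)]
  rw [ENNReal.le_div_iff_mul_le (by simp [Real.exp_pos]) (by simp), mul_comm]
  exact hmarkov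

/-- Chernoff's bound for the number of vertices with mark in `Z`. -/
lemma law_card_mark_mem_le (M : MCDGIRG d τ α) (n : ℕ)
    {Z : Set (ℝ × Torus d)} (hZ : MeasurableSet Z) {s q : ℝ} (hs : 0 ≤ s)
    (hq : M.vertexLaw.real Z ≤ q) (T : ℝ) :
    M.law n {ω | T ≤ ({v | mark ω v ∈ Z} : Set (Fin n)).ncard} ≤
      ENNReal.ofReal (Real.exp ((Real.exp s - 1) * (n * q) - s * T)) := by
  classical
  set F : Sample d n → ENNReal := fun ω => ∏ v : Fin n, ENNReal.ofReal (Real.exp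
      (if mark ω v ∈ Z then s else 0)) with hFdef
  have hH : Measurable fun z : ℝ × Torus d => ENNReal.ofReal (Real.exp
      (if z ∈ Z then s else 0)) :=
    (Real.measurable_exp.comp (Measurable.ite hZ measurable_const
      measurable_const)).ennreal_ofReal
  have hF : Measurable F :=
    Finset.measurable_prod _ fun v _ => hH.comp (measurable_mark v)
  have hsub : {ω : Sample d n | T ≤ ({v | mark ω v ∈ Z} : Set (Fin n)).ncard} ⊆
      {ω | ENNReal.ofReal (Real.exp (s * T)) ≤ F ω} := by
    intro ω h
    simp only [hFdef, Set.mem_ofPred_eq]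
    rw [← card_filter_exp]
    refine ENNReal.ofReal_le_ofReal (Real.exp_le_exp.2 (mul_le_mul_of_nonneg_left ?_ hs))
    refine le_trans h ?_
    rw [← Set.ncard_coe_finset]
    simp
  have hint : ∫⁻ ω, F ω ∂M.law n ≤ ENNReal.ofReal (Real.exp ((Real.exp s - 1) * (n * q))) := by
    rw [M.lintegral_law n hF]
    have hconst : ∀ z : Fin n → ℝ × Torus d, ∫⁻ U : Sym2 (Fin n) → unitInterval,
        F (fun v => (z v).1, fun v => (z v).2, U) =
        ∏ v : Fin n, ENNReal.ofReal (Real.exp (if z (id v) ∈ Z then s else 0)) := fun z =>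
      by
      refine (lintegral_const (μ := volume) (∏ v : Fin n, ENNReal.ofReal (Real.exp
        (if z v ∈ Z then s else 0)))).trans ?_
      rw [measure_univ, mul_one]
      rfl
    simp_rw [hconst]
    rw [lintegral_prod_pi_precomp M.vertexLaw Finset.univ Function.injective_id fun _ => hH]
    have h1 : ∫⁻ z, ENNReal.ofReal (Real.exp (if z ∈ Z then s else 0)) ∂M.vertexLaw ≤
        ENNReal.ofReal (Real.exp ((Real.exp s - 1) * q)) := by
      have h : ∀ z, ENNReal.ofReal (Real.exp (if z ∈ Z then s else 0)) =
          Z.indicator (fun _ => ENNReal.ofReal (Real.exp s - 1)) z + 1 := by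
        intro z
        by_cases hz : z ∈ Z
        · simp only [hz, if_true, Set.indicator_of_mem]
          rw [← ENNReal.ofReal_one, ← ENNReal.ofReal_add (by simpa using hs) zero_le_one]
          simp
        · simp [hz]
      simp_rw [h]
      rw [lintegral_add_right _ measurable_const, lintegral_indicator_const hZ, lintegral_const,
        measure_univ, mul_one]
      have he : 0 ≤ Real.exp s - 1 := by simpa using hs
      calc _ = ENNReal.ofReal ((Real.exp s - 1) * M.vertexLaw.real Z + 1) := by
            rw [ENNReal.ofReal_add (mul_nonneg he measureReal_nonneg) zero_le_one,
              ENNReal.ofReal_mul he, ofReal_measureReal, ENNReal.ofReal_one]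
        _ ≤ _ := ENNReal.ofReal_le_ofReal ((Real.add_one_le_exp _).trans
            (Real.exp_le_exp.2 (mul_le_mul_of_nonneg_left hq he)))
    refine (Finset.prod_le_prod' fun v _ => h1).trans ?_
    rw [Finset.prod_const, ← ENNReal.ofReal_pow (Real.exp_pos _).le, ← Real.exp_nat_mul,
      Finset.card_univ, Fintype.card_fin]
    refine ENNReal.ofReal_le_ofReal (Real.exp_le_exp.2 (le_of_eq (by ring)))
  have hmarkov := (mul_meas_ge_le_lintegral (μ := M.law n) hF
    (ENNReal.ofReal (Real.exp (s * T)))).trans hint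
  refine (measure_mono hsub).trans ?_
  rw [Real.exp_sub, ENNReal.ofReal_div_of_pos (Real.exp_pos _)]
  rw [ENNReal.le_div_iff_mul_le (by simp [Real.exp_pos]) (by simp), mul_comm]
  exact hmarkov

end MCDGIRG

end Concentration

/-! ### Mean degree of a vertex of given weight -/

section MeanDegree

lemma lintegral_comp_mul_left_pos {a : ℝ} (ha : 0 < a) {f : ℝ → ENNReal} (hf : Measurable f) :
    ∫⁻ s, f s = ENNReal.ofReal a * ∫⁻ t, f (a * t) := by
  conv_lhs => rw [← Real.smul_map_volume_mul_left ha.ne']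
  rw [lintegral_smul_measure, lintegral_map hf (measurable_const_mul a), abs_of_pos ha, smul_eq_mul]

lemma setLIntegral_Ioc_comp_div {a : ℝ} (ha : 0 < a) {g : ℝ → ENNReal} (hg : Measurable g) :
    ∫⁻ s in Set.Ioc 0 1, g (a / s) =
      ENNReal.ofReal a * ∫⁻ t in Set.Ioc 0 a⁻¹, g t⁻¹ := by
  have hga : Measurable fun s => g (a / s) := hg.comp (measurable_const.div measurable_id)
  rw [← lintegral_indicator measurableSet_Ioc, lintegral_comp_mul_left_pos ha
    (hga.indicator measurableSet_Ioc),
    ← lintegral_indicator measurableSet_Ioc]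
  congr 2
  ext t
  have : a * t ∈ Set.Ioc 0 1 ↔ t ∈ Set.Ioc 0 a⁻¹ := by
    rw [Set.mem_Ioc, Set.mem_Ioc, mul_pos_iff_of_pos_left ha, ← one_div, le_div_iff₀' ha]
  by_cases ht : t ∈ Set.Ioc 0 a⁻¹
  · rw [Set.indicator_of_mem ht, Set.indicator_of_mem (this.2 ht)]
    congr 1
    rw [← div_div, div_self ha.ne', one_div]
  · rw [Set.indicator_of_notMem ht, Set.indicator_of_notMem (mt this.1 ht)]

variable {h : ℝ → ℝ} {C α : ℝ}

/-- The integrand is at most C on (0, 1] and at most C t^(-α) beyond. Here α > 1 is essential: it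
makes the contribution of weak ties finite. -/
lemma lintegral_Ioi_comp_inv_lt_top (hα : 1 < α) (hC : 0 ≤ C)
    (hh : ∀ y, 0 < y → h y ≤ C * min y 1 ^ α) :
    ∫⁻ t in Set.Ioi 0, ENNReal.ofReal (h t⁻¹) < ⊤ := by
  rw [← Set.Ioc_union_Ioi_eq_Ioi zero_le_one,
    lintegral_union measurableSet_Ioi (Set.Ioc_disjoint_Ioi le_rfl)]
  refine ENNReal.add_lt_top.2 ⟨?_, ?_⟩
  · calc ∫⁻ t in Set.Ioc (0 : ℝ) 1, ENNReal.ofReal (h t⁻¹)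
        ≤ ∫⁻ t in Set.Ioc (0 : ℝ) 1, ENNReal.ofReal C := by
          refine setLIntegral_mono' measurableSet_Ioc fun t ht => ENNReal.ofReal_le_ofReal ?_
          have h1 : 1 ≤ t⁻¹ := (one_le_inv₀ ht.1).2 ht.2
          simpa [min_eq_right h1] using hh t⁻¹ (inv_pos.2 ht.1)
      _ < ⊤ := by simp
  · calc ∫⁻ t in Set.Ioi (1 : ℝ), ENNReal.ofReal (h t⁻¹)
        ≤ ∫⁻ t in Set.Ioi (1 : ℝ), ENNReal.ofReal (C * t ^ (-α)) := by
          refine setLIntegral_mono' measurableSet_Ioi fun t ht => ENNReal.ofReal_le_ofReal ?_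
          have ht' : (0 : ℝ) < t := zero_lt_one.trans ht
          refine (hh t⁻¹ (inv_pos.2 ht')).trans ?_
          rw [min_eq_left (inv_le_one_of_one_le₀ (le_of_lt ht)), Real.rpow_neg ht'.le,
            Real.inv_rpow ht'.le]
      _ = _ := by rw [setLIntegral_congr Ioi_ae_eq_Ici, setLIntegral_Ici_rpow hα zero_lt_one hC]
      _ < ⊤ := ENNReal.ofReal_lt_top

lemma lintegral_Ioi_comp_inv_pos {c : ℝ} (hc : 0 < c)
    (hh : ∀ y, 0 < y → c * min y 1 ^ α ≤ h y) :
    0 < ∫⁻ t in Set.Ioi 0, ENNReal.ofReal (h t⁻¹) := by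
  calc 0 < ENNReal.ofReal c := by simpa
    _ = ∫⁻ t in Set.Ioc (0 : ℝ) 1, ENNReal.ofReal c := by simp
    _ ≤ ∫⁻ t in Set.Ioc (0 : ℝ) 1, ENNReal.ofReal (h t⁻¹) := by
        refine setLIntegral_mono' measurableSet_Ioc fun t ht => ENNReal.ofReal_le_ofReal ?_
        have h1 : 1 ≤ t⁻¹ := (one_le_inv₀ ht.1).2 ht.2
        simpa [min_eq_right h1] using hh t⁻¹ (inv_pos.2 ht.1)
    _ ≤ _ := lintegral_mono_set Set.Ioc_subset_Ioi_self

/-- The mean of `W ∫_0^{1 / (δ W)} g(t) dt` tends to `𝔼 W ∫_0^∞ g(t) dt` as `δ → 0`. -/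
lemma tendsto_lintegral_mul_setLIntegral_Ioc {D : Measure ℝ} (hD : ∀ᵐ w ∂D, 1 ≤ w)
    {g : ℝ → ENNReal} :
    Tendsto (fun k : ℕ => ∫⁻ w, ENNReal.ofReal w *
        (∫⁻ t in Set.Ioc 0 (((k : ℝ) + 1)⁻¹ * w)⁻¹, g t) ∂D) atTop
      (𝓝 ((∫⁻ w, ENNReal.ofReal w ∂D) * ∫⁻ t in Set.Ioi 0, g t)) := by
  have hmono : ∀ w : ℝ, 0 < w → Monotone fun k : ℕ => Set.Ioc 0 (((k : ℝ) + 1)⁻¹ * w)⁻¹ := by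
    intro w hw k l hkl
    refine Set.Ioc_subset_Ioc_right ?_
    gcongr
  have hmeas : ∀ k : ℕ, Measurable fun w : ℝ =>
      ∫⁻ t in Set.Ioc 0 (((k : ℝ) + 1)⁻¹ * w)⁻¹, g t := by
    intro k
    have h1 : Monotone fun r : ℝ => ∫⁻ t in Set.Ioc 0 r, g t := fun r s hrs =>
      lintegral_mono_set (Set.Ioc_subset_Ioc_right hrs)
    exact h1.measurable.comp (by fun_prop)
  rw [← lintegral_mul_const _ (by fun_prop)]
  refine lintegral_tendsto_of_tendsto_of_monotone (fun k => ?_) ?_ ?_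
  · exact ((by fun_prop : Measurable fun w : ℝ => ENNReal.ofReal w).mul (hmeas k)).aemeasurable
  · filter_upwards [hD] with w hw k l hkl
    exact mul_le_mul_right (lintegral_mono_set (hmono w (by linarith) hkl)) _
  · filter_upwards [hD] with w hw
    have hw0 : 0 < w := by linarith
    refine ENNReal.Tendsto.const_mul ?_ (Or.inr ENNReal.ofReal_ne_top)
    have hU : Set.Ioi (0 : ℝ) = ⋃ k : ℕ, Set.Ioc 0 (((k : ℝ) + 1)⁻¹ * w)⁻¹ := by
      ext t
      simp only [Set.mem_Ioi, Set.mem_iUnion, Set.mem_Ioc]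
      constructor
      · intro ht
        obtain ⟨k, hk⟩ := exists_nat_ge (t * w)
        refine ⟨k, ht, ?_⟩
        rw [mul_inv, inv_inv, ← div_eq_mul_inv, le_div_iff₀ hw0]
        linarith
      · rintro ⟨k, h1, -⟩; exact h1
    rw [hU]
    have := tendsto_measure_iUnion_atTop (μ := volume.withDensity g) (hmono w hw0)
    simp_rw [Function.comp_def, withDensity_apply _ measurableSet_Ioc] at this
    rwa [withDensity_apply _ (MeasurableSet.iUnion fun _ => measurableSet_Ioc)] at this

variable {d : ℕ} {τ : ℝ}

namespace MCDGIRG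

variable (M : MCDGIRG d τ α)

lemma measurable_tieRatio (n : ℕ) (w : ℝ) (x : Torus d) :
    Measurable fun z : ℝ × Torus d => tieRatio n w z.1 x z.2 := by
  have h1 : Measurable fun z : ℝ × Torus d => volMin d (minNorm (x - z.2)) :=
    measurable_volMin.comp (measurable_minNorm.comp (by fun_prop))
  unfold tieRatio
  fun_prop

lemma ae_vertexLaw_one_le : ∀ᵐ z ∂M.vertexLaw, 1 ≤ z.1 :=
  Measure.quasiMeasurePreserving_fst.ae M.isPowerLaw.ae_one_le

lemma ae_vertexLaw_volMin_pos (hd : 0 < d) (x : Torus d) :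
    ∀ᵐ z ∂M.vertexLaw, 0 < volMin d (minNorm (x - z.2)) :=
  Measure.quasiMeasurePreserving_snd.ae (ae_volMin_minNorm_sub_pos hd x)

lemma ae_vertexLaw_tieRatio_pos (hd : 0 < d) {n : ℕ} (hn : 0 < n) {w : ℝ} (hw : 0 < w)
    (x : Torus d) : ∀ᵐ z ∂M.vertexLaw, 0 < tieRatio n w z.1 x z.2 := by
  filter_upwards [M.ae_vertexLaw_one_le, M.ae_vertexLaw_volMin_pos hd x] with z h1 h2
  have : (0 : ℝ) < n := by exact_mod_cast hn
  have : 0 < z.1 := by linarith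
  unfold tieRatio
  positivity

/-- The ball volume is a uniform variable s, and the substitution s = (w w'/n) t turns the tie ratio
into 1/t. The Jacobian supplies the factor w/n, so the weight w survives only there and in the
truncation point of the integral. -/
lemma lintegral_tieRatio (hd : 0 < d) {g : ℝ → ENNReal} (hg : Measurable g) {n : ℕ} (hn : 0 < n)
    {w : ℝ} (hw : 0 < w) (x : Torus d) :
    ∫⁻ z, g (tieRatio n w z.1 x z.2) ∂M.vertexLaw =
      ENNReal.ofReal (w / n) * ∫⁻ w', ENNReal.ofReal w' *
        (∫⁻ t in Set.Ioc 0 (w / n * w')⁻¹, g t⁻¹) ∂M.weightLaw := by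
  have hn' : (0 : ℝ) < n := by exact_mod_cast hn
  have hgm : Measurable fun z : ℝ × Torus d => g (tieRatio n w z.1 x z.2) :=
    hg.comp (measurable_tieRatio n w x)
  rw [vertexLaw, lintegral_prod _ hgm.aemeasurable,
    ← lintegral_const_mul' _ _ ENNReal.ofReal_ne_top]
  refine lintegral_congr_ae ?_
  filter_upwards [M.isPowerLaw.ae_one_le] with w' hw'
  have hw0 : 0 < w' := by linarith
  have h1 : ∀ y : Torus d, tieRatio n w w' x y = w / n * w' / volMin d (minNorm (x - y)) := by
    intro y
    rw [tieRatio]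
    field_simp
  simp_rw [h1]
  rw [lintegral_volMin_minNorm_sub hd (f := fun s => g (w / n * w' / s))
    (hg.comp (measurable_const.div measurable_id)), setLIntegral_Ioc_comp_div (by positivity) hg,
    ENNReal.ofReal_mul (by positivity), mul_assoc]

/-- If `0 ≤ h(y) ≤ C min(y, 1)^α`, then the mean of `h` of the tie ratio of a vertex of weight
`w = o(n)` and a random vertex is `(θ + o(1)) w / n`, where `θ = 𝔼 W ∫_0^∞ h(1/t) dt`. -/
lemma exists_mean_tieRatio (hd : 0 < d) (hτ : 2 < τ) (hα : 1 < α) (hh : Measurable h) (hC : 0 ≤ C)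
    (h0 : ∀ y, 0 < y → 0 ≤ h y) (hhC : ∀ y, 0 < y → h y ≤ C * min y 1 ^ α) :
    ∃ θ : ℝ, 0 ≤ θ ∧ ((∃ c : ℝ, 0 < c ∧ ∀ y, 0 < y → c * min y 1 ^ α ≤ h y) → 0 < θ) ∧
      (∀ n : ℕ, 0 < n → ∀ w : ℝ, 0 < w → ∀ x : Torus d,
        Integrable (fun z => h (tieRatio n w z.1 x z.2)) M.vertexLaw ∧
        ∫ z, h (tieRatio n w z.1 x z.2) ∂M.vertexLaw ≤ θ * (w / n)) ∧
      ∀ θ' < θ, ∃ δ : ℝ, 0 < δ ∧ ∀ n : ℕ, 0 < n → ∀ w : ℝ, 0 < w → w ≤ δ * n → ∀ x : Torus d,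
        θ' * (w / n) ≤ ∫ z, h (tieRatio n w z.1 x z.2) ∂M.vertexLaw := by
  set EW := ∫⁻ w, ENNReal.ofReal w ∂M.weightLaw with hEW
  set J := ∫⁻ t in Set.Ioi 0, ENNReal.ofReal (h t⁻¹) with hJ
  have hEWfin : EW ≠ ⊤ := (M.isPowerLaw.lintegral_lt_top hτ).ne
  have hJfin : J ≠ ⊤ := (lintegral_Ioi_comp_inv_lt_top hα hC hhC).ne
  have hEW1 : 1 ≤ EW := by
    calc (1 : ENNReal) = ∫⁻ w, 1 ∂M.weightLaw := by simp
      _ ≤ EW := lintegral_mono_ae (M.isPowerLaw.ae_one_le.mono fun w hw => by simpa using hw)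
  have hg : Measurable fun y => ENNReal.ofReal (h y) := hh.ennreal_ofReal
  have hupper : ∀ n : ℕ, 0 < n → ∀ w : ℝ, 0 < w → ∀ x : Torus d,
      ∫⁻ z, ENNReal.ofReal (h (tieRatio n w z.1 x z.2)) ∂M.vertexLaw ≤
        ENNReal.ofReal (w / n) * (EW * J) := by
    intro n hn w hw x
    rw [M.lintegral_tieRatio hd hg hn hw x]
    refine mul_le_mul_right ?_ _
    rw [hEW, ← lintegral_mul_const _ (by fun_prop)]
    refine lintegral_mono fun w' => mul_le_mul_right (lintegral_mono_set Set.Ioc_subset_Ioi_self) _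
  have hEJ : ENNReal.ofReal (EW * J).toReal = EW * J :=
    ENNReal.ofReal_toReal (ENNReal.mul_ne_top hEWfin hJfin)
  have hae : ∀ n : ℕ, 0 < n → ∀ w : ℝ, 0 < w → ∀ x : Torus d,
      0 ≤ᵐ[M.vertexLaw] fun z => h (tieRatio n w z.1 x z.2) := fun n hn w hw x =>
    (M.ae_vertexLaw_tieRatio_pos hd hn hw x).mono fun z hz => h0 _ hz
  have hmeas : ∀ (n : ℕ) (w : ℝ) (x : Torus d),
      AEStronglyMeasurable (fun z => h (tieRatio n w z.1 x z.2)) M.vertexLaw := fun n w x =>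
    (hh.comp (measurable_tieRatio n w x)).aestronglyMeasurable
  refine ⟨(EW * J).toReal, ENNReal.toReal_nonneg, ?_, ?_, ?_⟩
  · rintro ⟨c, hc, hch⟩
    refine ENNReal.toReal_pos (mul_ne_zero ?_ (lintegral_Ioi_comp_inv_pos hc hch).ne')
      (ENNReal.mul_ne_top hEWfin hJfin)
    exact (zero_lt_one.trans_le hEW1).ne'
  · intro n hn w hw x
    have hfin := (hupper n hn w hw x).trans_lt (ENNReal.mul_lt_top ENNReal.ofReal_lt_top
      (ENNReal.mul_lt_top hEWfin.lt_top hJfin.lt_top))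
    refine ⟨⟨hmeas n w x, ?_⟩, ?_⟩
    · rwa [hasFiniteIntegral_iff_ofReal (hae n hn w hw x)]
    · rw [integral_eq_lintegral_of_nonneg_ae (hae n hn w hw x) (hmeas n w x)]
      refine ENNReal.toReal_le_of_le_ofReal (by positivity) ((hupper n hn w hw x).trans ?_)
      rw [mul_comm, ENNReal.ofReal_mul ENNReal.toReal_nonneg, hEJ]
  · intro θ' hθ'
    rcases le_or_gt θ' 0 with hneg | hpos
    · refine ⟨1, one_pos, fun n hn w hw _ x => ?_⟩
      exact (mul_nonpos_of_nonpos_of_nonneg hneg (by positivity)).trans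
        (integral_nonneg_of_ae (hae n hn w hw x))
    have hlim := tendsto_lintegral_mul_setLIntegral_Ioc M.isPowerLaw.ae_one_le
      (g := fun t => ENNReal.ofReal (h t⁻¹))
    have hlt : ENNReal.ofReal θ' < EW * J := by
      rw [← hEJ]
      exact (ENNReal.ofReal_lt_ofReal_iff (hpos.trans hθ')).2 hθ'
    -- Monotone convergence gives one k whose truncated integral exceeds θ'. With δ = 1/(k + 1), the
    -- bound w ≤ δn moves the true truncation point at least as far out.
    obtain ⟨k, hk⟩ := (hlim.eventually (lt_mem_nhds hlt)).exists
    refine ⟨((k : ℝ) + 1)⁻¹, by positivity, fun n hn w hw hwn x => ?_⟩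
    have hn' : (0 : ℝ) < n := by exact_mod_cast hn
    have hfin := (hupper n hn w hw x).trans_lt (ENNReal.mul_lt_top ENNReal.ofReal_lt_top
      (ENNReal.mul_lt_top hEWfin.lt_top hJfin.lt_top))
    rw [integral_eq_lintegral_of_nonneg_ae (hae n hn w hw x) (hmeas n w x)]
    refine (ENNReal.ofReal_le_iff_le_toReal hfin.ne).1 ?_
    rw [M.lintegral_tieRatio hd hg hn hw x, mul_comm, ENNReal.ofReal_mul (by positivity)]
    refine mul_le_mul_right (hk.le.trans ?_) _
    refine lintegral_mono_ae ?_
    filter_upwards [M.isPowerLaw.ae_one_le] with w' hw'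
    refine mul_le_mul_right (lintegral_mono_set (Set.Ioc_subset_Ioc_right ?_)) _
    have hw0 : 0 < w' := by linarith
    have : w / n ≤ ((k : ℝ) + 1)⁻¹ := by rwa [div_le_iff₀ hn']
    gcongr

/-- The probability of the edge between `v` and `u`, as a function of their marks. -/
noncomputable def edgeProb (n : ℕ) (v u : Fin n) (z z' : ℝ × Torus d) : ℝ :=
  M.prob n v u z.1 z'.1 z.2 z'.2

lemma measurable_edgeProb (n : ℕ) (v u : Fin n) :
    Measurable (Function.uncurry (M.edgeProb n v u)) := by
  have : Measurable fun q : (ℝ × Torus d) × (ℝ × Torus d) => ((q.1.1, q.2.1), (q.1.2, q.2.2)) := by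
    fun_prop
  exact (M.prob_measurable n v u).comp this

lemma integrable_edgeProb (n : ℕ) (v u : Fin n) (z : ℝ × Torus d) :
    Integrable (M.edgeProb n v u z) M.vertexLaw :=
  Integrable.of_mem_Icc 0 1
    ((M.measurable_edgeProb n v u).comp measurable_prodMk_left).aemeasurable
    (Eventually.of_forall fun _ => M.prob_mem _ _ _ _ _ _ _)

lemma card_thinnedNbhd_edgeProb {n : ℕ} (v : Fin n) (ω : Sample d n) :
    (thinnedNbhd v (M.edgeProb n v) ω).card = M.deg ω v := by
  rw [deg, ← Set.ncard_coe_finset]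
  congr 1
  ext u
  rw [Finset.mem_coe, mem_thinnedNbhd, SimpleGraph.mem_neighborSet, Sym2.eq_swap, ne_comm]
  rfl

/-- The mean degree of a vertex of weight `w ≤ δ n` lies in `[a w, b w]`. -/
def HasMeanDegreeBounds (a b : ℝ) : Prop :=
  ∃ δ : ℝ, 0 < δ ∧ ∀ᶠ n : ℕ in atTop, ∀ v : Fin n, ∀ z : ℝ × Torus d, 1 ≤ z.1 → z.1 ≤ δ * n →
    ∑ u ∈ Finset.univ.erase v, ∫ z', M.edgeProb n v u z z' ∂M.vertexLaw ∈
      Set.Icc (a * z.1) (b * z.1)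

/-- Sum the mean edge probabilities over the n - 1 other vertices. The strict inequality a < θ₁
absorbs both the factor 1 - 1/n and the truncation loss; the upper bound needs no slack. -/
lemma hasMeanDegreeBounds_of_le_of_le (hd : 0 < d) {h₁ h₂ : ℝ → ℝ} {θ₁ θ₂ a b : ℝ}
    (ha : a < θ₁) (hb : θ₂ ≤ b) (hb0 : 0 ≤ θ₂)
    (hmean₁ : ∀ n : ℕ, 0 < n → ∀ w : ℝ, 0 < w → ∀ x : Torus d,
        Integrable (fun z => h₁ (tieRatio n w z.1 x z.2)) M.vertexLaw)
    (hlower : ∀ θ' < θ₁, ∃ δ : ℝ, 0 < δ ∧ ∀ n : ℕ, 0 < n → ∀ w : ℝ, 0 < w → w ≤ δ * n →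
      ∀ x : Torus d, θ' * (w / n) ≤ ∫ z, h₁ (tieRatio n w z.1 x z.2) ∂M.vertexLaw)
    (hupper : ∀ n : ℕ, 0 < n → ∀ w : ℝ, 0 < w → ∀ x : Torus d,
        Integrable (fun z => h₂ (tieRatio n w z.1 x z.2)) M.vertexLaw ∧
        ∫ z, h₂ (tieRatio n w z.1 x z.2) ∂M.vertexLaw ≤ θ₂ * (w / n))
    (hprob : ∀ᶠ n : ℕ in atTop, ∀ u v : Fin n, u ≠ v → ∀ w w' : ℝ, 1 ≤ w → 1 ≤ w' →
      ∀ x y : Torus d, minNorm (x - y) ≠ 0 →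
        h₁ (tieRatio n w w' x y) ≤ M.prob n u v w w' x y ∧
        M.prob n u v w w' x y ≤ h₂ (tieRatio n w w' x y)) :
    M.HasMeanDegreeBounds a b := by
  obtain ⟨θ', hθ1, hθ2⟩ := exists_between ha
  obtain ⟨δ, hδ, hδ'⟩ := hlower θ' hθ2
  refine ⟨δ, hδ, ?_⟩
  have hlim : ∀ᶠ n : ℕ in atTop, a ≤ (1 - 1 / (n : ℝ)) * θ' := by
    have h1 : Tendsto (fun n : ℕ => (1 - 1 / (n : ℝ)) * θ') atTop (𝓝 ((1 - 0) * θ')) :=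
      (tendsto_const_nhds.sub tendsto_one_div_atTop_nhds_zero_nat).mul_const _
    exact (h1.eventually (lt_mem_nhds (by simpa using hθ1))).mono fun n hn => hn.le
  filter_upwards [hprob, hlim, eventually_gt_atTop 0] with n hn hna hn0 v z hz1 hzn
  have hn' : (1 : ℝ) ≤ n := by exact_mod_cast hn0
  have hn0' : (0 : ℝ) < n := by linarith
  have hz0 : 0 < z.1 := by linarith
  have hterm : ∀ u ∈ Finset.univ.erase v, θ' * (z.1 / n) ≤ ∫ z', M.edgeProb n v u z z' ∂M.vertexLaw ∧
      ∫ z', M.edgeProb n v u z z' ∂M.vertexLaw ≤ θ₂ * (z.1 / n) := by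
    intro u hu
    have huv : v ≠ u := (Finset.ne_of_mem_erase hu).symm
    have hae : ∀ᵐ z' ∂M.vertexLaw, h₁ (tieRatio n z.1 z'.1 z.2 z'.2) ≤ M.edgeProb n v u z z' ∧
        M.edgeProb n v u z z' ≤ h₂ (tieRatio n z.1 z'.1 z.2 z'.2) := by
      filter_upwards [M.ae_vertexLaw_one_le, M.ae_vertexLaw_volMin_pos hd z.2] with z' h1 h2
      exact hn v u huv _ _ hz1 h1 _ _ (minNorm_ne_zero_of_volMin_pos hd h2)
    constructor
    · refine (hδ' n hn0 z.1 hz0 hzn z.2).trans ?_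
      exact integral_mono_ae (hmean₁ n hn0 z.1 hz0 z.2) (M.integrable_edgeProb n v u z)
        (hae.mono fun _ h => h.1)
    · refine le_trans ?_ (hupper n hn0 z.1 hz0 z.2).2
      exact integral_mono_ae (M.integrable_edgeProb n v u z) (hupper n hn0 z.1 hz0 z.2).1
        (hae.mono fun _ h => h.2)
  have hcard : ((Finset.univ.erase v).card : ℝ) = n - 1 := by
    rw [Finset.card_erase_of_mem (Finset.mem_univ v), Finset.card_univ, Fintype.card_fin]
    push_cast [hn0]
    rfl
  constructor
  · calc a * z.1 ≤ (1 - 1 / (n : ℝ)) * θ' * z.1 := by gcongr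
      _ = ((Finset.univ.erase v).card : ℝ) * (θ' * (z.1 / n)) := by
          rw [hcard]; field_simp
      _ ≤ _ := by
          rw [← nsmul_eq_mul]
          exact Finset.card_nsmul_le_sum _ _ _ fun u hu => (hterm u hu).1
  · calc ∑ u ∈ Finset.univ.erase v, ∫ z', M.edgeProb n v u z z' ∂M.vertexLaw
        ≤ ((Finset.univ.erase v).card : ℝ) * (θ₂ * (z.1 / n)) := by
          rw [← nsmul_eq_mul]
          exact Finset.sum_le_card_nsmul _ _ _ fun u hu => (hterm u hu).2
      _ ≤ n * (θ₂ * (z.1 / n)) := by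
          rw [hcard]
          gcongr
          linarith
      _ = θ₂ * z.1 := by field_simp
      _ ≤ b * z.1 := by gcongr

lemma exists_hasMeanDegreeBounds (hd : 0 < d) (hτ : 2 < τ) (hα : 1 < α) :
    ∃ a b : ℝ, 0 < a ∧ a ≤ b ∧ M.HasMeanDegreeBounds a b := by
  obtain ⟨c, C, hc, hC, hprob⟩ := M.prob_theta
  have hmeas : ∀ k : ℝ, Measurable fun y : ℝ => k * min y 1 ^ α := fun k => by fun_prop
  have hpos : ∀ k : ℝ, 0 < k → ∀ y : ℝ, 0 < y → 0 ≤ k * min y 1 ^ α := fun k hk y hy => by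
    positivity
  obtain ⟨θ₁, -, hθ₁, hu₁, hl₁⟩ := M.exists_mean_tieRatio hd hτ hα (hmeas c) hc.le (hpos c hc)
    fun y _ => le_rfl
  obtain ⟨θ₂, hθ₂, -, hu₂, -⟩ := M.exists_mean_tieRatio hd hτ hα (hmeas C) hC.le (hpos C hC)
    fun y _ => le_rfl
  have hθ₁ := hθ₁ ⟨c, hc, fun y _ => le_rfl⟩
  refine ⟨θ₁ / 2, max θ₂ (θ₁ / 2), by linarith, le_max_right _ _,
    M.hasMeanDegreeBounds_of_le_of_le hd (h₁ := fun y => c * min y 1 ^ α)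
      (h₂ := fun y => C * min y 1 ^ α) (θ₁ := θ₁) (by linarith)
      (le_max_left _ _) hθ₂ (fun n hn w hw x => (hu₁ n hn w hw x).1) hl₁ hu₂
      (Eventually.of_forall hprob)⟩

/-- Every positive value is a tie ratio of unit weights once n is large. This transfers bounds on
the edge probabilities to the limit function h at every point. -/
lemma exists_tieRatio_eq (hd : 0 < d) {y : ℝ} (hy : 0 < y) {n : ℕ} (hn : 0 < n)
    (hny : 1 / y ≤ n) :
    ∃ x x' : Torus d, minNorm (x - x') ≠ 0 ∧ tieRatio n 1 1 x x' = y := by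
  have hn' : (0 : ℝ) < n := by exact_mod_cast hn
  have hs : 1 / (n * y) ∈ Set.Icc (0 : ℝ) 1 := by
    refine ⟨by positivity, ?_⟩
    rw [div_le_one (by positivity)]
    rwa [div_le_iff₀ hy] at hny
  obtain ⟨r, hr, hrs⟩ := exists_volMin_eq hd hs
  have hnorm : minNorm ((fun _ => (r : UnitAddCircle)) - 0 : Torus d) = r := by
    have : Nonempty (Fin d) := ⟨⟨0, hd⟩⟩
    have h1 : ‖(r : UnitAddCircle)‖ = r := by
      rw [(AddCircle.norm_coe_eq_abs_iff 1 one_ne_zero).2]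
      · exact abs_of_nonneg hr.1
      · rw [abs_of_nonneg hr.1, abs_one]; exact hr.2
    simp [minNorm, h1]
  refine ⟨fun _ => (r : UnitAddCircle), 0, ?_, ?_⟩
  · apply minNorm_ne_zero_of_volMin_pos hd
    rw [hnorm, hrs]
    positivity
  · rw [tieRatio, hnorm, hrs]
    field_simp

/-- Both comparison functions are multiples of the same h, with factors 1 ± δ, so the two
mean-degree constants are close to the same θ. -/
lemma AsymptoticallyHomogeneous.exists_hasMeanDegreeBounds {M : MCDGIRG d τ α}
    (hM : M.AsymptoticallyHomogeneous) (hd : 0 < d) (hτ : 2 < τ) (hα : 1 < α)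
    {R : ℝ} (hR : 1 < R) :
    ∃ a b : ℝ, 0 < a ∧ b < R * a ∧ M.HasMeanDegreeBounds a b := by
  obtain ⟨h, hh, hM⟩ := hM
  obtain ⟨c, C, hc, hC, hprob⟩ := M.prob_theta
  have hbounds : ∀ y : ℝ, 0 < y → c / 2 * min y 1 ^ α ≤ h y ∧ h y ≤ 2 * C * min y 1 ^ α := by
    intro y hy
    -- Relative error 1/2 at a single large n already yields the constants c/2 and 2C. At least two
    -- vertices are needed to have a pair.
    obtain ⟨n, hn1, hn2, hn3⟩ := ((hM (1 / 2) (by norm_num)).and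
      ((eventually_ge_atTop 2).and (eventually_ge_atTop ⌈1 / y⌉₊))).exists
    obtain ⟨x, x', hne, hxy⟩ := exists_tieRatio_eq hd hy (n := n) (by omega) (Nat.ceil_le.1 hn3)
    have hne01 : (⟨0, by omega⟩ : Fin n) ≠ ⟨1, by omega⟩ := by simp
    have h1 := hn1 ⟨0, by omega⟩ ⟨1, by omega⟩ hne01 1 1 le_rfl le_rfl x x' hne
    have h2 := hprob n ⟨0, by omega⟩ ⟨1, by omega⟩ hne01 1 1 le_rfl le_rfl x x' hne
    rw [hxy] at h1 h2
    have h3 := abs_le.1 h1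
    have h4 : 0 ≤ c * min y 1 ^ α := by positivity
    have h5 : 0 ≤ C * min y 1 ^ α := by positivity
    constructor <;> linarith [h3.1, h3.2, h2.1, h2.2]
  have hpos : ∀ y : ℝ, 0 < y → 0 ≤ h y := fun y hy =>
    (by positivity : 0 ≤ c / 2 * min y 1 ^ α).trans (hbounds y hy).1
  obtain ⟨θ, -, hθ, hu, hl⟩ := M.exists_mean_tieRatio hd hτ hα hh (by positivity : 0 ≤ 2 * C) hpos
    fun y hy => (hbounds y hy).2
  have hθ := hθ ⟨c / 2, by positivity, fun y hy => (hbounds y hy).1⟩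
  -- Chosen so that 1 + δ < R(1 - 2δ). The lower constant uses 1 - 2δ instead of 1 - δ to stay
  -- strictly below θ₁.
  set δ := min (1 / 2) ((R - 1) / (4 * (R + 1))) with hδ
  have hδ0 : 0 < δ := by
    have : 0 < R - 1 := by linarith
    have : 0 < R + 1 := by linarith
    positivity
  have hδ1 : δ ≤ 1 / 2 := min_le_left _ _
  have hδ2 : (1 + δ) < R * (1 - 2 * δ) := by
    have h1 : δ ≤ (R - 1) / (4 * (R + 1)) := min_le_right _ _
    rw [le_div_iff₀ (by linarith)] at h1
    nlinarith
  refine ⟨(1 - 2 * δ) * θ, (1 + δ) * θ, ?_, ?_, ?_⟩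
  · have : 0 < 1 - 2 * δ := by nlinarith
    positivity
  · nlinarith
  · refine M.hasMeanDegreeBounds_of_le_of_le hd (h₁ := fun y => (1 - δ) * h y)
      (h₂ := fun y => (1 + δ) * h y) (θ₁ := (1 - δ) * θ) (θ₂ := (1 + δ) * θ) (by nlinarith)
      le_rfl (by positivity) (fun n hn w hw x => (hu n hn w hw x).1.const_mul _) ?_ ?_ ?_
    · intro θ' hθ'
      have h1δ : 0 < 1 - δ := by linarith
      obtain ⟨ε, hε, hε'⟩ := hl (θ' / (1 - δ)) (by rwa [div_lt_iff₀ h1δ, mul_comm])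
      refine ⟨ε, hε, fun n hn w hw hwn x => ?_⟩
      rw [integral_const_mul]
      have := hε' n hn w hw hwn x
      calc θ' * (w / n) = (1 - δ) * (θ' / (1 - δ) * (w / n)) := by field_simp
        _ ≤ _ := by gcongr
    · intro n hn w hw x
      refine ⟨(hu n hn w hw x).1.const_mul _, ?_⟩
      rw [integral_const_mul, mul_assoc]
      gcongr
      exact (hu n hn w hw x).2
    · filter_upwards [hM δ hδ0] with n hn u v huv w w' hw hw' x y hxy
      have := abs_le.1 (hn u v huv w w' hw hw' x y hxy)
      constructor <;> linarith [this.1, this.2]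

end MCDGIRG

end MeanDegree

/-! ### Deterministic expansion from two partitions -/

section CellExpansion

variable {T : Type*} [Finite T] {H : SimpleGraph T}

/-- If every vertex has at least `k` neighbours in its own class, then a set meeting `a` classes
has at least `k a` vertices in its closed neighbourhood. -/
lemma mul_ncard_image_le_ncard_extNbhd_add (f : T → ℕ) {k : ℝ}
    (hk : ∀ v, k ≤ ({u | H.Adj v u ∧ f u = f v} : Set T).ncard) (S : Set T) :
    k * (f '' S).ncard ≤ (extNbhd H S).ncard + S.ncard := by
  classical
  have := Fintype.ofFinite T
  rcases S.eq_empty_or_nonempty with rfl | ⟨v₀, -⟩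
  · simp
  have : Nonempty T := ⟨v₀⟩
  -- One representative in S for each class met; their neighbourhoods within their own classes are
  -- pairwise disjoint.
  choose! g hgS hgf using fun j (hj : j ∈ f '' S) => hj
  set A : Finset ℕ := (Set.toFinite (f '' S)).toFinset with hA
  have hmemA : ∀ j, j ∈ A ↔ j ∈ f '' S := fun j => Set.Finite.mem_toFinset _
  set B : ℕ → Finset T := fun j => {u | H.Adj (g j) u ∧ f u = f (g j)} with hB
  have hdisj : Set.PairwiseDisjoint (A : Set ℕ) B := by
    intro i hi j hj hij
    rw [Function.onFun, Finset.disjoint_left]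
    intro u hu1 hu2
    simp only [hB, Finset.mem_filter, Finset.mem_univ, true_and] at hu1 hu2
    rw [hgf i ((hmemA i).1 hi)] at hu1
    rw [hgf j ((hmemA j).1 hj)] at hu2
    exact hij (hu1.2.symm.trans hu2.2)
  have hsub : ((A.biUnion B : Finset T) : Set T) ⊆ extNbhd H S ∪ S := by
    intro u hu
    simp only [Finset.coe_biUnion, Set.mem_iUnion, Finset.mem_coe, hB, Finset.mem_filter,
      Finset.mem_univ, true_and] at hu
    obtain ⟨j, hj, hu1, -⟩ := hu
    by_cases huS : u ∈ S
    · exact Or.inr huS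
    · exact Or.inl ⟨huS, g j, hgS j ((hmemA j).1 hj), hu1⟩
  have h1 : ((A.biUnion B).card : ℝ) ≤ (extNbhd H S).ncard + S.ncard := by
    rw [← Set.ncard_coe_finset]
    exact_mod_cast (Set.ncard_le_ncard hsub (Set.toFinite _)).trans (Set.ncard_union_le _ _)
  refine le_trans ?_ h1
  rw [Finset.card_biUnion hdisj, Set.ncard_eq_toFinset_card (f '' S) (Set.toFinite _), ← hA]
  push_cast
  rw [mul_comm, ← nsmul_eq_mul]
  refine Finset.card_nsmul_le_sum _ _ _ fun j _ => ?_
  refine (hk (g j)).trans (le_of_eq ?_)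
  rw [← Set.ncard_coe_finset]
  simp [hB]

/-- If S meets at most a classes of each partition, its neighbourhood grows like κKa while S is
confined to an a × a rectangle. The smallness conditions on δ and ε, and K ≥ 40/κ, ensure that the
closed neighbourhood exceeds S by enough to leave the required external part. -/
lemma isExpandingSet_of_two_partitions {f₀ f₁ : T → ℕ} {m : ℕ} {κ K δ M ε : ℝ}
    (hm : 0 < m) (hf₀ : ∀ v, f₀ v < m) (hf₁ : ∀ v, f₁ v < m)
    (hκ : 0 < κ) (hM : 1 ≤ M) (hε : 0 < ε) (hδ1 : δ ≤ 1) (hδκ : 4 * δ ≤ κ ^ 2)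
    (hK : 40 / κ ≤ K) (hε1 : ε ≤ 1) (hεκ : 40 * ε * M ≤ κ) (hεδ : 2 * ε * M ≤ κ * δ)
    (hnbr₀ : ∀ v, κ * K ≤ ({u | H.Adj v u ∧ f₀ u = f₀ v} : Set T).ncard)
    (hnbr₁ : ∀ v, κ * K ≤ ({u | H.Adj v u ∧ f₁ u = f₁ v} : Set T).ncard)
    (hrect : ∀ a : ℕ, 1 ≤ a → a ≤ δ * m → ∀ A ⊆ Finset.range m, ∀ B ⊆ Finset.range m,
      A.card = a → B.card = a → (({v | f₀ v ∈ A ∧ f₁ v ∈ B} : Set T).ncard : ℝ) ≤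
        max (20 * (a : ℝ)) (K * a * (a / m : ℝ) ^ (1 / 2 : ℝ)))
    (hcard : (Nat.card T : ℝ) ≤ M * K * m) {S : Set T} (hS : S.Nonempty)
    (hSε : (S.ncard : ℝ) ≤ ε * Nat.card T) :
    IsExpandingSet H (ε * min K ((Nat.card T / S.ncard : ℝ) ^ (1 / 3 : ℝ))) S := by
  classical
  rw [IsExpandingSet]
  have hm' : (0 : ℝ) < m := by exact_mod_cast hm
  have hK0 : 0 < K := lt_of_lt_of_le (by positivity) hK
  have hκK : 40 ≤ κ * K := by rw [div_le_iff₀' hκ] at hK; exact hK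
  set N : ℝ := ((Nat.card T : ℕ) : ℝ) with hN
  set s : ℝ := ((S.ncard : ℕ) : ℝ) with hs
  set Y : ℝ := (((extNbhd H S).ncard : ℕ) : ℝ) with hY
  have hs1 : 1 ≤ s := by
    have : 1 ≤ S.ncard := (Set.ncard_pos (Set.toFinite S)).2 hS
    rw [hs]; exact_mod_cast this
  have hs0 : 0 < s := by linarith
  have hsN : s ≤ N := hSε.trans (mul_le_of_le_one_left (by positivity) hε1)
  have h0 := mul_ncard_image_le_ncard_extNbhd_add f₀ hnbr₀ S
  have h1 := mul_ncard_image_le_ncard_extNbhd_add f₁ hnbr₁ S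
  set a : ℕ := max (f₀ '' S).ncard (f₁ '' S).ncard with ha
  have hkey : κ * K * a ≤ Y + s := by
    rcases max_choice (f₀ '' S).ncard (f₁ '' S).ncard with h | h <;> rw [ha, h] <;> assumption
  have ha1 : 1 ≤ a := le_trans ((Set.ncard_pos (Set.toFinite _)).2 (hS.image f₀)) (le_max_left _ _)
  have ha0 : (0 : ℝ) < a := by exact_mod_cast ha1
  rcases le_or_gt (a : ℝ) (δ * m) with hcase | hcase
  · have ham : a ≤ m := by
      have : (a : ℝ) ≤ m := hcase.trans (mul_le_of_le_one_left hm'.le hδ1)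
      exact_mod_cast this
    -- Both index sets are padded to exactly a elements, as the rectangle hypothesis asks for
    -- squares.
    have hext : ∀ f : T → ℕ, (∀ v, f v < m) → (f '' S).ncard ≤ a →
        ∃ A ⊆ Finset.range m, A.card = a ∧ ∀ v ∈ S, f v ∈ A := by
      intro f hf hfa
      have hsubset : (Set.toFinite (f '' S)).toFinset ⊆ Finset.range m := by
        intro j hj
        obtain ⟨v, -, rfl⟩ := (Set.Finite.mem_toFinset _).1 hj
        exact Finset.mem_range.2 (hf v)
      rw [Set.ncard_eq_toFinset_card (f '' S) (Set.toFinite _)] at hfa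
      obtain ⟨A, hA1, hA2, hA3⟩ := Finset.exists_subsuperset_card_eq hsubset hfa (by simpa using ham)
      exact ⟨A, hA2, hA3, fun v hv => hA1 ((Set.Finite.mem_toFinset _).2 ⟨v, hv, rfl⟩)⟩
    obtain ⟨A, hA1, hA2, hA3⟩ := hext f₀ hf₀ (le_max_left _ _)
    obtain ⟨B, hB1, hB2, hB3⟩ := hext f₁ hf₁ (le_max_right _ _)
    have hsle : s ≤ max (20 * (a : ℝ)) (K * a * (a / m : ℝ) ^ (1 / 2 : ℝ)) := by
      refine le_trans ?_ (hrect a ha1 hcase A hA1 B hB1 hA2 hB2)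
      rw [hs]
      have hsub : S ⊆ {v | f₀ v ∈ A ∧ f₁ v ∈ B} := fun v hv => ⟨hA3 v hv, hB3 v hv⟩
      exact_mod_cast Set.ncard_le_ncard hsub (Set.toFinite _)
    rcases le_max_iff.1 hsle with h | h
    · have hmin : min K ((N / s) ^ (1 / 3 : ℝ)) ≤ K := min_le_left _ _
      have h2 : ε * min K ((N / s) ^ (1 / 3 : ℝ)) * s ≤ ε * K * s := by gcongr
      have h3 : κ * K * s ≤ 20 * (Y + s) := by
        calc κ * K * s ≤ κ * K * (20 * a) := by gcongr
          _ ≤ _ := by linarith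
      have h4 : 40 * s ≤ κ * K * s := by gcongr
      have h5 : 40 * ε * K * s ≤ κ * K * s := by
        gcongr
        refine le_trans ?_ hεκ
        exact le_mul_of_one_le_right (by positivity) hM
      linarith
    -- Dense rectangle: with q = √(m/a) and X = Ka/s, the rectangle bound reads q ≤ X. The condition
    -- on δ gives κq ≥ 2, so half of κXs pays for S itself.
    · set r : ℝ := m / a with hr
      have hr0 : 0 < r := by positivity
      have hrδ : 4 / κ ^ 2 ≤ r := by
        rw [hr, div_le_div_iff₀ (by positivity) ha0]
        nlinarith
      have hsqrt : (a / m : ℝ) ^ (1 / 2 : ℝ) = (Real.sqrt r)⁻¹ := by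
        rw [Real.sqrt_eq_rpow, ← Real.inv_rpow hr0.le, hr, inv_div]
      have hq0 : 0 < Real.sqrt r := Real.sqrt_pos.2 hr0
      have hqq : Real.sqrt r ^ 2 = r := Real.sq_sqrt hr0.le
      set q := Real.sqrt r with hq
      rw [hsqrt] at h
      set X : ℝ := K * a / s with hX
      have hX0 : 0 < X := by positivity
      have hXs : X * s = K * a := by rw [hX]; field_simp
      have hqX : q ≤ X := by
        rw [hX, le_div_iff₀ hs0]
        calc q * s ≤ q * (K * a * q⁻¹) := by gcongr
          _ = K * a := by field_simp
      have hqκ : 2 ≤ κ * q := by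
        have h2 : 4 ≤ κ ^ 2 * q ^ 2 := by
          rw [hqq]
          rwa [div_le_iff₀' (by positivity)] at hrδ
        nlinarith [mul_pos hκ hq0]
      -- One factor X comes from K/s and two from m/a = q² ≤ X². This cube is the origin of the
      -- exponent 1/3.
      have hNs : N / s ≤ (M * X) ^ 3 := by
        calc N / s ≤ M * K * m / s := by gcongr
          _ = M * X * r := by rw [hX, hr]; field_simp
          _ = M * X * q ^ 2 := by rw [hqq]
          _ ≤ M * X * X ^ 2 := by gcongr
          _ = M * X ^ 3 := by ring
          _ ≤ M ^ 3 * X ^ 3 := by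
              gcongr
              exact le_self_pow₀ hM (by norm_num)
          _ = _ := by ring
      have hroot : (N / s) ^ (1 / 3 : ℝ) ≤ M * X := by
        calc (N / s) ^ (1 / 3 : ℝ) ≤ ((M * X) ^ 3) ^ (1 / 3 : ℝ) := by
              gcongr
          _ = M * X := by
              rw [← Real.rpow_natCast, ← Real.rpow_mul (by positivity)]
              norm_num
      have h2 : ε * min K ((N / s) ^ (1 / 3 : ℝ)) * s ≤ ε * (M * X) * s := by
        gcongr
        exact (min_le_right _ _).trans hroot
      have h3 : 2 * s ≤ κ * X * s := by
        gcongr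
        exact hqκ.trans (by gcongr)
      have h4 : κ * X * s = κ * K * a := by rw [mul_assoc, hXs]; ring
      have h5 : 40 * ε * M * (X * s) ≤ κ * (X * s) := by gcongr
      have h6 : 0 ≤ ε * M * (X * s) := by positivity
      linarith
  -- Many classes: the closed neighbourhood has more than κδKm ≥ 2εMKm elements, S has at most εN ≤
  -- εMKm, and the target is at most εN.
  · have hpow : (N / s) ^ (1 / 3 : ℝ) ≤ N / s := by
      have h1 : 1 ≤ N / s := by rwa [one_le_div hs0]
      calc (N / s) ^ (1 / 3 : ℝ) ≤ (N / s) ^ (1 : ℝ) := by gcongr; norm_num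
        _ = _ := Real.rpow_one _
    have h2 : ε * min K ((N / s) ^ (1 / 3 : ℝ)) * s ≤ ε * N := by
      calc _ ≤ ε * (N / s) * s := by
            gcongr
            exact (min_le_right _ _).trans hpow
        _ = ε * N := by field_simp
    have h3 : ε * N ≤ ε * (M * K * m) := by gcongr
    have h4 : κ * K * (δ * m) ≤ κ * K * a := by gcongr
    have h5 : 2 * ε * M * (K * m) ≤ κ * δ * (K * m) := by gcongr
    linarith

end CellExpansion

/-! ### Growth of the scale ℓ and of the number of arcs -/

section Asymptotics

/-- The scale `log^γ n` of the weights. -/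
noncomputable def logPow (γ : ℝ) (n : ℕ) : ℝ := Real.log n ^ γ

/-- The number of arcs of each coordinate circle. -/
noncomputable def arcCount (γ : ℝ) (n : ℕ) : ℕ := ⌈(n : ℝ) / logPow γ n ^ 2⌉₊

lemma tendsto_log_natCast : Tendsto (fun n : ℕ => Real.log n) atTop atTop :=
  Real.tendsto_log_atTop.comp tendsto_natCast_atTop_atTop

lemma tendsto_logPow {γ : ℝ} (hγ : 0 < γ) : Tendsto (logPow γ) atTop atTop :=
  (tendsto_rpow_atTop hγ).comp tendsto_log_natCast

lemma logPow_rpow (γ β : ℝ) (n : ℕ) : logPow γ n ^ β = logPow (γ * β) n :=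
  (Real.rpow_mul (Real.log_natCast_nonneg n) _ _).symm

/-- With β > 1, log^β n eventually exceeds any multiple of log n, so the failure probabilities
survive a union bound over n vertices. -/
lemma tendsto_mul_exp_neg_logPow {β c : ℝ} (hβ : 1 < β) (hc : 0 < c) :
    Tendsto (fun n : ℕ => n * Real.exp (-(c * logPow β n))) atTop (𝓝 0) := by
  have h1 : Tendsto (fun n : ℕ => ((n : ℝ))⁻¹) atTop (𝓝 0) := tendsto_inv_atTop_nhds_zero_nat
  refine squeeze_zero' (Eventually.of_forall fun n => by positivity) ?_ h1
  filter_upwards [(tendsto_logPow (by linarith : 0 < β - 1)).eventually_ge_atTop (2 / c),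
    tendsto_log_natCast.eventually_gt_atTop 0, eventually_gt_atTop 0] with n h2 h3 h4
  have hn : (0 : ℝ) < n := by exact_mod_cast h4
  have h5 : logPow β n = logPow (β - 1) n * Real.log n := by
    rw [logPow, logPow, ← Real.rpow_add_one h3.ne']; congr 1; ring
  have h6 : 2 * Real.log n ≤ c * logPow β n := by
    rw [div_le_iff₀' hc] at h2
    rw [h5, ← mul_assoc]
    gcongr
  calc n * Real.exp (-(c * logPow β n)) ≤ n * Real.exp (-(2 * Real.log n)) := by gcongr
    _ = (n : ℝ)⁻¹ := by
        rw [two_mul, neg_add, Real.exp_add, Real.exp_neg, Real.exp_log hn]; field_simp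

lemma tendsto_div_logPow (γ : ℝ) :
    Tendsto (fun n : ℕ => (n : ℝ) / logPow γ n) atTop atTop := by
  have h := (isLittleO_log_rpow_rpow_atTop γ one_pos).comp_tendsto tendsto_natCast_atTop_atTop
  have h1 : Tendsto (fun n : ℕ => logPow γ n / n) atTop (𝓝 0) := by
    refine h.tendsto_div_nhds_zero.congr fun n => ?_
    simp [logPow]
  have h2 : Tendsto (fun n : ℕ => logPow γ n / n) atTop (𝓝[>] 0) := by
    refine tendsto_nhdsWithin_iff.2 ⟨h1, ?_⟩
    filter_upwards [tendsto_log_natCast.eventually_gt_atTop 0, eventually_gt_atTop 0] with n h3 h4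
    have hn : (0 : ℝ) < n := by exact_mod_cast h4
    exact div_pos (Real.rpow_pos_of_pos h3 _) hn
  exact h2.inv_tendsto_nhdsGT_zero.congr fun n => by simp [inv_div]

lemma le_arcCount_mul {γ : ℝ} {n : ℕ} (h : 0 < logPow γ n) :
    (n : ℝ) ≤ arcCount γ n * logPow γ n ^ 2 := by
  have := Nat.le_ceil ((n : ℝ) / logPow γ n ^ 2)
  rwa [div_le_iff₀ (by positivity)] at this

lemma tendsto_div_logPow_sq (γ : ℝ) :
    Tendsto (fun n : ℕ => (n : ℝ) / logPow γ n ^ 2) atTop atTop := by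
  refine (tendsto_div_logPow (γ * 2)).congr fun n => ?_
  rw [← logPow_rpow]
  norm_num

lemma eventually_arcCount_mul_le (γ : ℝ) :
    ∀ᶠ n : ℕ in atTop, arcCount γ n * logPow γ n ^ 2 ≤ 2 * n := by
  filter_upwards [(tendsto_div_logPow_sq γ).eventually_ge_atTop 1,
    tendsto_log_natCast.eventually_gt_atTop 0] with n h1 h2
  have h3 : 0 < logPow γ n := Real.rpow_pos_of_pos h2 _
  have h4 := Nat.ceil_lt_add_one (zero_le_one.trans h1)
  have h5 : (arcCount γ n : ℝ) ≤ 2 * (n / logPow γ n ^ 2) := by rw [arcCount]; linarith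
  calc (arcCount γ n : ℝ) * logPow γ n ^ 2 ≤ 2 * (n / logPow γ n ^ 2) * logPow γ n ^ 2 := by
        gcongr
    _ = 2 * (n : ℝ) := by field_simp

lemma tendsto_arcCount (γ : ℝ) : Tendsto (arcCount γ) atTop atTop :=
  tendsto_nat_ceil_atTop.comp (tendsto_div_logPow_sq γ)

end Asymptotics

/-! ### High-probability events, and degrees within arcs -/

section Cells

variable {d : ℕ} {τ α : ℝ}

namespace MCDGIRG

variable (M : MCDGIRG d τ α)

/-- The outer probability of the complement of `E n` tends to `0`. -/
def Overwhelming (E : (n : ℕ) → Set (Sample d n)) : Prop :=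
  Tendsto (fun n => M.law n (E n)ᶜ) atTop (𝓝 0)

variable {M}

lemma Overwhelming.mono {E F : (n : ℕ) → Set (Sample d n)} (h : M.Overwhelming E)
    (hEF : ∀ᶠ n in atTop, E n ⊆ F n) : M.Overwhelming F :=
  tendsto_of_tendsto_of_tendsto_of_le_of_le' tendsto_const_nhds h
    (Eventually.of_forall fun _ => zero_le)
    (hEF.mono fun _ h => measure_mono (Set.compl_subset_compl.2 h))

lemma Overwhelming.inter {E F : (n : ℕ) → Set (Sample d n)} (hE : M.Overwhelming E)
    (hF : M.Overwhelming F) : M.Overwhelming fun n => E n ∩ F n := by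
  have h := Tendsto.add hE hF
  rw [add_zero] at h
  refine tendsto_of_tendsto_of_tendsto_of_le_of_le tendsto_const_nhds h (fun _ => zero_le)
    fun n => ?_
  simp only [Set.compl_inter]
  exact measure_union_le _ _

/-- Bounding the outer measure of the complement suffices by subadditivity, so the events need not
be shown measurable. -/
lemma Overwhelming.whp {E : (n : ℕ) → Set (Sample d n)} (h : M.Overwhelming E) : M.Whp E := by
  have h1 : Tendsto (fun n => 1 - M.law n (E n)ᶜ) atTop (𝓝 (1 - 0)) :=
    ENNReal.Tendsto.sub tendsto_const_nhds h (Or.inl ENNReal.one_ne_top)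
  rw [tsub_zero] at h1
  refine tendsto_of_tendsto_of_tendsto_of_le_of_le h1 tendsto_const_nhds (fun n => ?_)
    fun n => prob_le_one
  rw [tsub_le_iff_right, ← measure_univ (μ := M.law n), ← Set.union_compl_self (E n)]
  exact measure_union_le _ _

lemma overwhelming_of_le {E : (n : ℕ) → Set (Sample d n)} {b : ℕ → ℝ}
    (hE : ∀ᶠ n in atTop, M.law n (E n)ᶜ ≤ ENNReal.ofReal (b n)) (hb : Tendsto b atTop (𝓝 0)) :
    M.Overwhelming E := by
  have h := ENNReal.tendsto_ofReal hb
  rw [ENNReal.ofReal_zero] at h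
  exact tendsto_of_tendsto_of_tendsto_of_le_of_le' tendsto_const_nhds h
    (Eventually.of_forall fun _ => zero_le) hE

lemma overwhelming_forall {P : (n : ℕ) → Fin n → Sample d n → Prop} {b : ℕ → ℝ}
    (hP : ∀ᶠ n in atTop, ∀ v, M.law n {ω | ¬ P n v ω} ≤ ENNReal.ofReal (b n))
    (hb : Tendsto (fun n : ℕ => n * b n) atTop (𝓝 0)) :
    M.Overwhelming fun n => {ω | ∀ v, P n v ω} := by
  refine overwhelming_of_le ?_ hb
  filter_upwards [hP] with n hn
  have : ({ω | ∀ v, P n v ω} : Set (Sample d n))ᶜ = ⋃ v, {ω | ¬ P n v ω} := by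
    ext ω; simp
  rw [this]
  refine (measure_iUnion_fintype_le _ _).trans ((Finset.sum_le_sum fun v _ => hn v).trans ?_)
  rw [Finset.sum_const, Finset.card_univ, Fintype.card_fin, nsmul_eq_mul,
    ENNReal.ofReal_mul (by positivity), ENNReal.ofReal_natCast]

variable (M)

lemma overwhelming_one_le : M.Overwhelming fun _ => {ω | ∀ v, 1 ≤ ω.1 v} := by
  refine overwhelming_forall (b := fun _ => 0) (Eventually.of_forall fun n v => ?_) (by simp)
  have h : ∀ᵐ ω ∂M.law n, 1 ≤ ω.1 v :=
    Measure.quasiMeasurePreserving_fst.ae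
      ((Measure.quasiMeasurePreserving_eval (fun _ : Fin n => M.weightLaw) v).ae
        M.isPowerLaw.ae_one_le)
  have : M.law n {ω | ¬ 1 ≤ ω.1 v} = 0 := h
  rw [this]
  exact zero_le

lemma volume_torus_coordinate (i : Fin d) {s : Set UnitAddCircle} (hs : MeasurableSet s) :
    volume {x : Torus d | x i ∈ s} = volume s :=
  (measurePreserving_eval (fun _ : Fin d => (volume : Measure UnitAddCircle)) i).measure_preimage
    hs.nullMeasurableSet

lemma volume_torus_two_coordinates {i j : Fin d} (hij : i ≠ j) {s t : Set UnitAddCircle}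
    (hs : MeasurableSet s) (ht : MeasurableSet t) :
    volume {x : Torus d | x i ∈ s ∧ x j ∈ t} = volume s * volume t := by
  have h := (ProbabilityTheory.iIndepFun_pi
    (μ := fun _ : Fin d => (volume : Measure UnitAddCircle)) (X := fun _ => id)
    fun _ => aemeasurable_id).indepFun hij
  have h2 := h.measure_inter_preimage_eq_mul s t hs ht
  rw [← volume_torus_coordinate i hs, ← volume_torus_coordinate j ht]
  exact h2

/-- Edges between vertices of weight at least `c₀ log^γ n` and `c₁ log^γ n` on the same arc are
present with probability bounded away from `0`. -/
lemma exists_le_edgeProb_of_arcIndex_eq (hd : 0 < d) (γ : ℝ) (hα : 0 < α) {c₀ c₁ : ℝ} (hc₀ : 0 < c₀)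
    (hc₁ : 0 < c₁) (hγ : 0 < γ) :
    ∃ p₀ : ℝ, 0 < p₀ ∧ ∀ᶠ n : ℕ in atTop, ∀ u v : Fin n, v ≠ u → ∀ z z' : ℝ × Torus d,
      c₀ * logPow γ n ≤ z.1 → c₁ * logPow γ n ≤ z'.1 → 0 < volMin d (minNorm (z.2 - z'.2)) →
      ∀ i, arcIndex (arcCount γ n) (z'.2 i) = arcIndex (arcCount γ n) (z.2 i) →
        p₀ ≤ M.edgeProb n v u z z' := by
  obtain ⟨c, C, hc, hC, hprob⟩ := M.prob_theta
  have hd' : (0 : ℝ) < d := by exact_mod_cast hd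
  refine ⟨c * min (c₀ * c₁ / (2 * d)) 1 ^ α, by positivity, ?_⟩
  filter_upwards [(tendsto_logPow hγ).eventually_ge_atTop (1 / c₀),
    (tendsto_logPow hγ).eventually_ge_atTop (1 / c₁), (tendsto_arcCount γ).eventually_gt_atTop 0,
    eventually_gt_atTop 0] with n h1 h2 hm hn0 u v huv z z' hz hz' hV i harc
  rw [div_le_iff₀' hc₀] at h1
  rw [div_le_iff₀' hc₁] at h2
  have hn0' : (0 : ℝ) < n := by exact_mod_cast hn0
  have hm' : (0 : ℝ) < arcCount γ n := by exact_mod_cast hm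
  have hl : 0 < logPow γ n := by
    by_contra hcon
    nlinarith
  refine le_trans ?_ (hprob n v u huv z.1 z'.1 (by linarith) (by linarith) z.2 z'.2
    (minNorm_ne_zero_of_volMin_pos hd hV)).1
  gcongr c * min ?_ 1 ^ α
  rw [tieRatio, div_le_div_iff₀ (by positivity) (by positivity)]
  have hV2 : volMin d (minNorm (z.2 - z'.2)) ≤ 2 * d * (1 / arcCount γ n) :=
    (volMin_le_mul hd (minNorm_nonneg _)).trans (by
      gcongr
      exact minNorm_sub_le_of_arcIndex_eq hm harc.symm)
  have hnV : n * volMin d (minNorm (z.2 - z'.2)) ≤ 2 * d * logPow γ n ^ 2 := by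
    calc n * volMin d (minNorm (z.2 - z'.2))
        ≤ (arcCount γ n * logPow γ n ^ 2) * (2 * d * (1 / arcCount γ n)) := by
          gcongr
          exact le_arcCount_mul hl
      _ = _ := by field_simp
  calc c₀ * c₁ * (n * volMin d (minNorm (z.2 - z'.2)))
      ≤ c₀ * c₁ * (2 * d * logPow γ n ^ 2) := by gcongr
    _ = (c₀ * logPow γ n) * (c₁ * logPow γ n) * (2 * d) := by ring
    _ ≤ _ := by
        have := hz.trans' (by positivity : 0 ≤ c₀ * logPow γ n)
        gcongr

/-- Every vertex of weight at least `c₀ log^γ n` has `Ω(log^{γ(3-τ)} n)` neighbours of weight in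
`[c₁ log^γ n, c₂ log^γ n]` on its own arc. -/
lemma exists_overwhelming_le_ncard_nbhd (hd : 0 < d) {γ : ℝ} (hα : 0 < α) (hτ : 2 < τ) (hτ3 : τ < 3)
    (hγ : 1 / (3 - τ) < γ) {c₀ c₁ c₂ : ℝ} (hc₀ : 0 < c₀) (hc₁ : 0 < c₁) (hc₂ : c₁ < c₂)
    (i : Fin d) :
    ∃ κ : ℝ, 0 < κ ∧ M.Overwhelming fun n => {ω | ∀ v, c₀ * logPow γ n ≤ ω.1 v →
      κ * logPow γ n ^ (3 - τ) ≤ ({u | ω.1 u ∈ Set.Icc (c₁ * logPow γ n) (c₂ * logPow γ n) ∧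
        (M.graph ω).Adj v u ∧ arcIndex (arcCount γ n) (ω.2.1 u i) =
          arcIndex (arcCount γ n) (ω.2.1 v i)} : Set (Fin n)).ncard} := by
  classical
  have h3τ : 0 < 3 - τ := by linarith
  have hγ0 : 0 < γ := lt_trans (by positivity) hγ
  have hβ : 1 < γ * (3 - τ) := by rwa [div_lt_iff₀ h3τ] at hγ
  obtain ⟨p₀, hp₀, hedge⟩ := M.exists_le_edgeProb_of_arcIndex_eq hd γ hα hc₀ hc₁ hγ0
  obtain ⟨c, hc, hlaw⟩ := M.isPowerLaw.le_measure_Icc (by linarith) hc₁ hc₂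
  -- The 4 comes from mℓ² ≤ 2n and n ≤ 2(n - 1).
  set κ₀ := p₀ * c / 4 with hκ₀
  have hκ₀0 : 0 < κ₀ := by positivity
  refine ⟨κ₀ / 2, by positivity, ?_⟩
  -- Chernoff with s = -1: since 1 - 1/e ≥ 3/5 and the threshold is half of κ₀K, the exponent is
  -- -(3/5 - 1/2)κ₀K.
  refine overwhelming_forall (b := fun n => Real.exp (-(κ₀ / 10 * logPow (γ * (3 - τ)) n))) ?_
    (tendsto_mul_exp_neg_logPow hβ (by positivity))
  filter_upwards [hedge, (tendsto_logPow hγ0).eventually hlaw, eventually_arcCount_mul_le γ,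
    (tendsto_arcCount γ).eventually_gt_atTop 0, eventually_ge_atTop 2,
    (tendsto_logPow hγ0).eventually_gt_atTop 0] with n hedge hlaw hmn hm hn2 hl v
  have hn2' : (2 : ℝ) ≤ n := by exact_mod_cast hn2
  have hm' : (0 : ℝ) < arcCount γ n := by exact_mod_cast hm
  set ℓ := logPow γ n with hℓ
  set m := arcCount γ n with hmdef
  set G : ℝ × Torus d → Set (ℝ × Torus d) := fun z =>
    Set.Icc (c₁ * ℓ) (c₂ * ℓ) ×ˢ {x | arcIndex m (x i) = arcIndex m (z.2 i)} with hG
  -- Setting the probability to 0 outside the window and the arc makes the thinned neighbourhood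
  -- exactly the set to be counted.
  set p : Fin n → ℝ × Torus d → ℝ × Torus d → ℝ := fun u z z' =>
    if z' ∈ G z then M.edgeProb n v u z z' else 0 with hp
  have harcm : Measurable fun x : Torus d => arcIndex m (x i) :=
    (measurable_arcIndex m).comp (measurable_pi_apply i)
  have hpm : ∀ u, Measurable (Function.uncurry (p u)) := by
    intro u
    refine Measurable.ite ?_ (M.measurable_edgeProb n v u) measurable_const
    refine MeasurableSet.inter ?_ ?_
    · exact (measurable_fst.comp measurable_snd) measurableSet_Icc
    · exact measurableSet_eq_fun (harcm.comp (measurable_snd.comp measurable_snd))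
        (harcm.comp (measurable_snd.comp measurable_fst))
  have hp01 : ∀ u z z', p u z z' ∈ Set.Icc (0 : ℝ) 1 := by
    intro u z z'
    simp only [hp]
    split_ifs
    · exact M.prob_mem _ _ _ _ _ _ _
    · exact ⟨le_rfl, zero_le_one⟩
  have hZ : MeasurableSet {z : ℝ × Torus d | c₀ * ℓ ≤ z.1} :=
    measurable_fst measurableSet_Ici
  have hGmeas : ∀ z, c * ℓ ^ (1 - τ) / m ≤ M.vertexLaw.real (G z) := by
    intro z
    have harc : volume {x : Torus d | arcIndex m (x i) = arcIndex m (z.2 i)} =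
        ENNReal.ofReal (1 / m) := by
      rw [← volume_arcIndex_eq (arcIndex_lt hm (z.2 i))]
      exact volume_torus_coordinate i (measurable_arcIndex m (measurableSet_singleton _))
    refine (ENNReal.ofReal_le_iff_le_toReal (measure_ne_top _ _)).1 ?_
    rw [hG, vertexLaw, Measure.prod_prod, harc, div_eq_mul_one_div, ENNReal.ofReal_mul (by positivity)]
    gcongr
  have hmean : ∀ z ∈ {z : ℝ × Torus d | c₀ * ℓ ≤ z.1},
      (Real.exp (-1) - 1) * ∑ u ∈ Finset.univ.erase v, ∫ z', p u z z' ∂M.vertexLaw ≤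
        -(3 / 5) * (κ₀ * ℓ ^ (3 - τ)) := by
    intro z hz
    have hterm : ∀ u ∈ Finset.univ.erase v,
        p₀ * (c * ℓ ^ (1 - τ) / m) ≤ ∫ z', p u z z' ∂M.vertexLaw := by
      intro u hu
      have hGm : MeasurableSet (G z) :=
        measurableSet_Icc.prod (harcm (measurableSet_singleton _))
      calc p₀ * (c * ℓ ^ (1 - τ) / m) ≤ p₀ * M.vertexLaw.real (G z) := by
            gcongr; exact hGmeas z
        _ = ∫ z', (G z).indicator (fun _ => p₀) z' ∂M.vertexLaw := by
            rw [integral_indicator_const _ hGm, smul_eq_mul, mul_comm]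
        _ ≤ _ := by
            refine integral_mono_ae ((integrable_const p₀).indicator hGm)
              (Integrable.of_mem_Icc 0 1 ((hpm u).comp measurable_prodMk_left).aemeasurable
                (Eventually.of_forall fun z' => hp01 u z z')) ?_
            filter_upwards [M.ae_vertexLaw_volMin_pos hd z.2] with z' hz'
            by_cases hzG : z' ∈ G z
            · simp only [Set.indicator_of_mem hzG, hp, if_pos hzG]
              exact hedge u v (Finset.ne_of_mem_erase hu).symm z z' hz hzG.1.1 hz' i hzG.2
            · simp [hp, hzG]
    have hcard : ((Finset.univ.erase v).card : ℝ) = n - 1 := by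
      rw [Finset.card_erase_of_mem (Finset.mem_univ v), Finset.card_univ, Fintype.card_fin]
      push_cast [show 1 ≤ n by omega]
      rfl
    have hsum : κ₀ * ℓ ^ (3 - τ) ≤ ∑ u ∈ Finset.univ.erase v, ∫ z', p u z z' ∂M.vertexLaw := by
      calc κ₀ * ℓ ^ (3 - τ) = p₀ * c * ℓ ^ (1 - τ) * (ℓ ^ 2 / 4) := by
            rw [hκ₀, show 3 - τ = (1 - τ) + 2 by ring, Real.rpow_add hl, Real.rpow_two]; ring
        _ ≤ p₀ * c * ℓ ^ (1 - τ) * ((n - 1) / m) := by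
            gcongr p₀ * c * ℓ ^ (1 - τ) * ?_
            rw [div_le_div_iff₀ (by norm_num) hm']
            nlinarith
        _ = ((Finset.univ.erase v).card : ℝ) * (p₀ * (c * ℓ ^ (1 - τ) / m)) := by
            rw [hcard]; ring
        _ ≤ _ := by
            rw [← nsmul_eq_mul]
            exact Finset.card_nsmul_le_sum _ _ _ hterm
    have hexp : Real.exp (-1) ≤ 2 / 5 := by
      rw [Real.exp_neg]
      have := Real.exp_one_gt_d9
      rw [inv_le_comm₀ (Real.exp_pos 1) (by norm_num)]
      linarith
    have : 0 ≤ κ₀ * ℓ ^ (3 - τ) := by positivity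
    nlinarith
  have hchern := M.law_thinnedNbhd_le v hpm hp01 hZ hmean (κ₀ / 2 * ℓ ^ (3 - τ))
  refine (measure_mono ?_).trans (hchern.trans (le_of_eq ?_))
  · intro ω hω
    simp only [Set.mem_ofPred_eq, Classical.not_imp, not_le] at hω
    refine ⟨hω.1, ?_⟩
    have hset : ({u | ω.1 u ∈ Set.Icc (c₁ * ℓ) (c₂ * ℓ) ∧
        (M.graph ω).Adj v u ∧ arcIndex m (ω.2.1 u i) = arcIndex m (ω.2.1 v i)} : Set (Fin n)) =
        thinnedNbhd v p ω := by
      ext u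
      rw [Finset.mem_coe, mem_thinnedNbhd]
      have hnn : 0 ≤ (ω.2.2 s(u, v) : ℝ) := (ω.2.2 s(u, v)).2.1
      by_cases hu : mark ω u ∈ G (mark ω v)
      · have h1 : ω.1 u ∈ Set.Icc (c₁ * ℓ) (c₂ * ℓ) := hu.1
        have h2 : arcIndex m (ω.2.1 u i) = arcIndex m (ω.2.1 v i) := hu.2
        simp only [hp, if_pos hu, Set.mem_ofPred_eq, h1, h2, true_and, and_true]
        rw [Sym2.eq_swap, ne_comm]
        rfl
      · simp only [hp, if_neg hu, hnn.not_gt, and_false, Set.mem_ofPred_eq, iff_false]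
        rintro ⟨h1, -, h2⟩
        exact hu ⟨h1, h2⟩
    have h2 := hω.2
    rw [hset, Set.ncard_coe_finset] at h2
    linarith
  · rw [hℓ, logPow_rpow]
    congr 2
    ring

/-- The expected number of vertices of weight at least `c₀ log^γ n` in a rectangle of `a × a`
cells. -/
lemma exists_mul_vertexLaw_rectangle_le {γ : ℝ} (hτ : 1 < τ) (hγ : 0 < γ) {c₀ : ℝ} (hc₀ : 0 < c₀)
    {i j : Fin d} (hij : i ≠ j) :
    ∃ C : ℝ, 1 ≤ C ∧ ∀ᶠ n : ℕ in atTop, ∀ A ⊆ Finset.range (arcCount γ n),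
      ∀ B ⊆ Finset.range (arcCount γ n), A.card = B.card →
      n * M.vertexLaw.real {z | c₀ * logPow γ n ≤ z.1 ∧ arcIndex (arcCount γ n) (z.2 i) ∈ A ∧
        arcIndex (arcCount γ n) (z.2 j) ∈ B} ≤
          C * logPow γ n ^ (3 - τ) * (A.card * (A.card / arcCount γ n)) := by
  obtain ⟨C, hC, hlaw⟩ := M.isPowerLaw.measure_Ici_le hτ
  refine ⟨max 1 (C * c₀ ^ (1 - τ)), le_max_left _ _, ?_⟩
  filter_upwards [(tendsto_logPow hγ).eventually_ge_atTop (1 / c₀),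
    (tendsto_logPow hγ).eventually_gt_atTop 0, (tendsto_arcCount γ).eventually_gt_atTop 0]
    with n h1 hl hm A hA B hB hAB
  rw [div_le_iff₀' hc₀] at h1
  have hm' : (0 : ℝ) < arcCount γ n := by exact_mod_cast hm
  have hset : {z : ℝ × Torus d | c₀ * logPow γ n ≤ z.1 ∧ arcIndex (arcCount γ n) (z.2 i) ∈ A ∧
      arcIndex (arcCount γ n) (z.2 j) ∈ B} = Set.Ici (c₀ * logPow γ n) ×ˢ
      {x | x i ∈ {y | arcIndex (arcCount γ n) y ∈ A} ∧
        x j ∈ {y | arcIndex (arcCount γ n) y ∈ B}} := rfl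
  have hms : ∀ A : Finset ℕ, MeasurableSet {y | arcIndex (arcCount γ n) y ∈ A} := fun A =>
    measurable_arcIndex _ A.measurableSet
  have hreal : M.vertexLaw.real {z : ℝ × Torus d | c₀ * logPow γ n ≤ z.1 ∧
      arcIndex (arcCount γ n) (z.2 i) ∈ A ∧ arcIndex (arcCount γ n) (z.2 j) ∈ B} ≤
      C * (c₀ * logPow γ n) ^ (1 - τ) * ((A.card / arcCount γ n) * (A.card / arcCount γ n)) := by
    rw [hset, measureReal_def, vertexLaw, Measure.prod_prod,
      volume_torus_two_coordinates hij (hms A) (hms B), volume_arcIndex_mem hA,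
      volume_arcIndex_mem hB, ← hAB]
    refine ENNReal.toReal_le_of_le_ofReal (by positivity) ?_
    rw [ENNReal.ofReal_mul (by positivity), ENNReal.ofReal_mul (by positivity : (0:ℝ) ≤ A.card / _)]
    gcongr
    exact hlaw _ h1
  calc n * M.vertexLaw.real _
      ≤ (arcCount γ n * logPow γ n ^ 2) * (C * (c₀ * logPow γ n) ^ (1 - τ) *
        ((A.card / arcCount γ n) * (A.card / arcCount γ n))) := by
        gcongr
        exact le_arcCount_mul hl
    _ = C * c₀ ^ (1 - τ) * logPow γ n ^ (3 - τ) * (A.card * (A.card / arcCount γ n)) := by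
        rw [Real.mul_rpow hc₀.le hl.le, show 3 - τ = (1 - τ) + 2 by ring, Real.rpow_add hl,
          Real.rpow_two]
        field_simp
    _ ≤ _ := by
        gcongr
        exact le_max_right _ _

end MCDGIRG

end Cells

/-! ### Union bound over rectangles, and the sandwich criterion -/

section Rectangles

lemma choose_le_exp {m a : ℕ} (ha : 0 < a) (hm : 0 < m) :
    (m.choose a : ℝ) ≤ Real.exp (a * (1 + Real.log (m / a))) := by
  have ha' : (0 : ℝ) < a := by exact_mod_cast ha
  have hm' : (0 : ℝ) < m := by exact_mod_cast hm
  have h1 : (m.choose a : ℝ) ≤ (m : ℝ) ^ a / a.factorial := Nat.choose_le_pow_div a m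
  have h2 : (a : ℝ) ^ a / a.factorial ≤ Real.exp a := Real.pow_div_factorial_le_exp a ha'.le a
  calc (m.choose a : ℝ) ≤ (m : ℝ) ^ a / a.factorial := h1
    _ = (m / a : ℝ) ^ a * ((a : ℝ) ^ a / a.factorial) := by rw [div_pow]; field_simp
    _ ≤ (m / a : ℝ) ^ a * Real.exp a := by gcongr
    _ = Real.exp (a * (1 + Real.log (m / a))) := by
        rw [mul_add, mul_one, Real.exp_add, mul_comm, Real.exp_nat_mul,
          Real.exp_log (by positivity)]

/-- With L = log(m/a), there are at most exp(2a(1 + L)) pairs of index sets. Multiplying by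
exp(-5aL) leaves at most exp(-2aL), and aL ≥ log m. -/
lemma choose_mul_choose_mul_exp_le {m a : ℕ} (ha : 0 < a) (hm : 0 < m)
    (h : 4 ≤ Real.log (m / a)) :
    (m.choose a : ℝ) * (m.choose a * Real.exp (-(5 * a * Real.log (m / a)))) ≤
      ((m : ℝ) ^ 2)⁻¹ := by
  have ha' : (1 : ℝ) ≤ a := by exact_mod_cast ha
  have hm' : (0 : ℝ) < m := by exact_mod_cast hm
  have hlogm : Real.log m ≤ a * Real.log (m / a) := by
    have h1 : Real.log m = Real.log (m / a) + Real.log a := by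
      rw [← Real.log_mul (by positivity) (by positivity)]; congr 1; field_simp
    have h2 : Real.log a ≤ a - 1 := Real.log_le_sub_one_of_pos (by linarith)
    nlinarith
  have h3 := choose_le_exp ha hm
  calc (m.choose a : ℝ) * (m.choose a * Real.exp (-(5 * a * Real.log (m / a))))
      ≤ Real.exp (a * (1 + Real.log (m / a))) * (Real.exp (a * (1 + Real.log (m / a))) *
        Real.exp (-(5 * a * Real.log (m / a)))) := by gcongr
    _ = Real.exp (a * (1 + Real.log (m / a)) + (a * (1 + Real.log (m / a)) +
        -(5 * a * Real.log (m / a)))) := by rw [Real.exp_add, Real.exp_add]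
    _ ≤ Real.exp (-(2 * Real.log m)) := by
        gcongr
        nlinarith
    _ = ((m : ℝ) ^ 2)⁻¹ := by
        rw [Real.exp_neg, ← Real.log_rpow hm', Real.exp_log (by positivity), Real.rpow_two]

variable {d : ℕ} {τ α : ℝ}

namespace MCDGIRG

variable (M : MCDGIRG d τ α)

/-- A rectangle of `a × a` cells contains at most `max (20 a, K a √(a / m))` vertices of weight at
least `c₀ log^γ n`, if `a` is at most a small multiple of the number `m` of arcs. -/
lemma exists_overwhelming_rectangle_le {γ : ℝ} (hτ : 1 < τ) (hγ : 0 < γ) {c₀ : ℝ} (hc₀ : 0 < c₀)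
    {i j : Fin d} (hij : i ≠ j) :
    ∃ δ : ℝ, 0 < δ ∧ M.Overwhelming fun n => {ω | ∀ a : ℕ, 1 ≤ a → a ≤ δ * arcCount γ n →
      ∀ A ⊆ Finset.range (arcCount γ n), ∀ B ⊆ Finset.range (arcCount γ n),
        A.card = a → B.card = a →
        (({v | c₀ * logPow γ n ≤ ω.1 v ∧ arcIndex (arcCount γ n) (ω.2.1 v i) ∈ A ∧
          arcIndex (arcCount γ n) (ω.2.1 v j) ∈ B} : Set (Fin n)).ncard : ℝ) ≤
        max (20 * (a : ℝ)) (logPow γ n ^ (3 - τ) * a * (a / arcCount γ n : ℝ) ^ (1 / 2 : ℝ))} := by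
  classical
  obtain ⟨C, hC, hmean⟩ := M.exists_mul_vertexLaw_rectangle_le hτ hγ hc₀ hij
  -- This forces log(m/a) ≥ 4C ≥ 4.
  refine ⟨Real.exp (-(4 * C)), Real.exp_pos _, ?_⟩
  refine overwhelming_of_le (b := fun n => ((arcCount γ n : ℝ))⁻¹) ?_
    (tendsto_inv_atTop_zero.comp (tendsto_natCast_atTop_atTop.comp (tendsto_arcCount γ)))
  filter_upwards [hmean, (tendsto_arcCount γ).eventually_gt_atTop 0,
    (tendsto_logPow hγ).eventually_gt_atTop 0] with n hmean hm hl
  set m := arcCount γ n with hmdef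
  set K := logPow γ n ^ (3 - τ) with hK
  have hm' : (0 : ℝ) < m := by exact_mod_cast hm
  have hK0 : 0 ≤ K := by positivity
  set Z : Finset ℕ → Finset ℕ → Set (ℝ × Torus d) := fun A B =>
    {z | c₀ * logPow γ n ≤ z.1 ∧ arcIndex m (z.2 i) ∈ A ∧ arcIndex m (z.2 j) ∈ B} with hZ
  have hZm : ∀ A B, MeasurableSet (Z A B) := fun A B =>
    (measurable_fst measurableSet_Ici).inter
      ((((measurable_arcIndex m).comp ((measurable_pi_apply i).comp measurable_snd))
        A.measurableSet).inter
      (((measurable_arcIndex m).comp ((measurable_pi_apply j).comp measurable_snd))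
        B.measurableSet))
  set t : ℕ → ℝ := fun a => max (20 * (a : ℝ)) (K * a * (a / m : ℝ) ^ (1 / 2 : ℝ)) with ht
  set I := (Finset.Icc 1 m).filter fun a : ℕ => (a : ℝ) ≤ Real.exp (-(4 * C)) * m with hI
  have hlog : ∀ a ∈ I, 4 * C ≤ Real.log (m / a) := by
    intro a ha
    obtain ⟨ha1, ha2⟩ := Finset.mem_filter.1 ha
    have ha0 : (0 : ℝ) < a := by exact_mod_cast (Finset.mem_Icc.1 ha1).1
    rw [Real.le_log_iff_exp_le (by positivity), le_div_iff₀ ha0]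
    calc Real.exp (4 * C) * a ≤ Real.exp (4 * C) * (Real.exp (-(4 * C)) * m) := by gcongr
      _ = m := by rw [← mul_assoc, ← Real.exp_add]; simp
  have hbad : ∀ a ∈ I, ∀ A ∈ (Finset.range m).powersetCard a,
      ∀ B ∈ (Finset.range m).powersetCard a,
      M.law n {ω | t a ≤ ({v | mark ω v ∈ Z A B} : Set (Fin n)).ncard} ≤
        ENNReal.ofReal (Real.exp (-(5 * a * Real.log (m / a)))) := by
    intro a ha A hA B hB
    have hL := hlog a ha
    have ha0 : (0 : ℝ) < a := by
      exact_mod_cast (Finset.mem_Icc.1 (Finset.mem_filter.1 ha).1).1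
    rw [Finset.mem_powersetCard] at hA hB
    have hq := hmean A hA.1 B hB.1 (hA.2.trans hB.2.symm)
    rw [hA.2] at hq
    set L := Real.log (m / a) with hLdef
    have hL0 : 0 ≤ L := by linarith
    -- With s = L/2, e^s = √(m/a) lifts the mean CKa(a/m) to CKa√(a/m) ≤ C t ≤ (L/4) t. Against s t
    -- = (L/2) t this leaves -(L/4) t ≤ -5aL, as t ≥ 20a.
    refine (M.law_card_mark_mem_le n (hZm A B) (s := L / 2) (by linarith) le_rfl (t a)).trans ?_
    refine ENNReal.ofReal_le_ofReal (Real.exp_le_exp.2 ?_)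
    have hexpL : Real.exp (-L) = a / m := by
      rw [hLdef, Real.exp_neg, Real.exp_log (by positivity), inv_div]
    have hroot : (a / m : ℝ) ^ (1 / 2 : ℝ) = Real.exp (-(L / 2)) := by
      rw [← hexpL, ← Real.exp_mul]; congr 1; ring
    have h1 : (Real.exp (L / 2) - 1) * (n * M.vertexLaw.real (Z A B)) ≤
        C * (K * a * Real.exp (-(L / 2))) := by
      calc _ ≤ Real.exp (L / 2) * (n * M.vertexLaw.real (Z A B)) := by
            gcongr
            linarith
        _ ≤ Real.exp (L / 2) * (C * K * (a * (a / m))) := by gcongr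
        _ = C * (K * a * (Real.exp (L / 2) * Real.exp (-L))) := by rw [hexpL]; ring
        _ = _ := by rw [← Real.exp_add]; ring_nf
    have h2 : 20 * (a : ℝ) ≤ t a := le_max_left _ _
    have h3 : K * a * Real.exp (-(L / 2)) ≤ t a := hroot ▸ le_max_right _ _
    have h4 : C * (K * a * Real.exp (-(L / 2))) ≤ L / 4 * t a := by
      calc _ ≤ L / 4 * (K * a * Real.exp (-(L / 2))) := by gcongr; linarith
        _ ≤ _ := by gcongr
    have h5 : L / 4 * (20 * a) ≤ L / 4 * t a := by gcongr
    linarith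
  have hsub : ({ω | ∀ a : ℕ, 1 ≤ a → a ≤ Real.exp (-(4 * C)) * m →
      ∀ A ⊆ Finset.range m, ∀ B ⊆ Finset.range m, A.card = a → B.card = a →
        (({v | c₀ * logPow γ n ≤ ω.1 v ∧ arcIndex m (ω.2.1 v i) ∈ A ∧
          arcIndex m (ω.2.1 v j) ∈ B} : Set (Fin n)).ncard : ℝ) ≤ t a} : Set (Sample d n))ᶜ ⊆
      ⋃ a ∈ I, ⋃ A ∈ (Finset.range m).powersetCard a, ⋃ B ∈ (Finset.range m).powersetCard a,
        {ω | t a ≤ ({v | mark ω v ∈ Z A B} : Set (Fin n)).ncard} := by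
    intro ω hω
    simp only [Set.mem_compl_iff, Set.mem_ofPred_eq, not_forall, not_le] at hω
    obtain ⟨a, ha1, ha2, A, hA, B, hB, hAa, hBa, h⟩ := hω
    simp only [Set.mem_iUnion]
    refine ⟨a, ?_, A, Finset.mem_powersetCard.2 ⟨hA, hAa⟩, B, Finset.mem_powersetCard.2 ⟨hB, hBa⟩,
      h.le⟩
    refine Finset.mem_filter.2 ⟨Finset.mem_Icc.2 ⟨ha1, ?_⟩, ha2⟩
    rw [← hAa]
    simpa using Finset.card_le_card hA
  refine (measure_mono hsub).trans ?_
  have hsum : ∀ a ∈ I, M.law n (⋃ A ∈ (Finset.range m).powersetCard a,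
      ⋃ B ∈ (Finset.range m).powersetCard a,
        {ω | t a ≤ ({v | mark ω v ∈ Z A B} : Set (Fin n)).ncard}) ≤
      ENNReal.ofReal (((m : ℝ) ^ 2)⁻¹) := by
    intro a ha
    have ha0 : 0 < a := (Finset.mem_Icc.1 (Finset.mem_filter.1 ha).1).1
    refine le_trans ?_ (ENNReal.ofReal_le_ofReal (choose_mul_choose_mul_exp_le ha0 hm
      (by linarith [hlog a ha])))
    calc _ ≤ ∑ A ∈ (Finset.range m).powersetCard a, ∑ B ∈ (Finset.range m).powersetCard a,
          ENNReal.ofReal (Real.exp (-(5 * a * Real.log (m / a)))) :=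
          (measure_biUnion_finset_le _ _).trans (Finset.sum_le_sum fun A hA =>
            (measure_biUnion_finset_le _ _).trans (Finset.sum_le_sum fun B hB =>
              hbad a ha A hA B hB))
      _ = _ := by
          rw [Finset.sum_const, Finset.sum_const, Finset.card_powersetCard, Finset.card_range,
            nsmul_eq_mul, nsmul_eq_mul, ENNReal.ofReal_mul (by positivity),
            ENNReal.ofReal_mul (by positivity), ENNReal.ofReal_natCast]
  refine (measure_biUnion_finset_le _ _).trans ((Finset.sum_le_sum hsum).trans ?_)
  rw [Finset.sum_const, nsmul_eq_mul, ← ENNReal.ofReal_natCast,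
    ← ENNReal.ofReal_mul (by positivity)]
  refine ENNReal.ofReal_le_ofReal ?_
  have hcardI : (I.card : ℝ) ≤ m := by
    have := Finset.card_filter_le (Finset.Icc 1 m) fun a : ℕ => (a : ℝ) ≤ Real.exp (-(4 * C)) * m
    rw [Nat.card_Icc, Nat.add_sub_cancel] at this
    exact_mod_cast this
  calc (I.card : ℝ) * ((m : ℝ) ^ 2)⁻¹ ≤ m * ((m : ℝ) ^ 2)⁻¹ := by gcongr
    _ = (m : ℝ)⁻¹ := by field_simp

/-- The number of vertices of weight at least `c₀ log^γ n` is `O(n log^{γ(1-τ)} n)`. -/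
lemma exists_overwhelming_ncard_weight_le {γ : ℝ} (hτ : 1 < τ) (hτ3 : τ < 3) (hγ : 0 < γ)
    {c₀ : ℝ} (hc₀ : 0 < c₀) {i j : Fin d} (hij : i ≠ j) :
    ∃ C : ℝ, 1 ≤ C ∧ M.Overwhelming fun n => {ω |
      (({v | c₀ * logPow γ n ≤ ω.1 v} : Set (Fin n)).ncard : ℝ) ≤
        C * logPow γ n ^ (3 - τ) * arcCount γ n} := by
  obtain ⟨C, hC, hmean⟩ := M.exists_mul_vertexLaw_rectangle_le hτ hγ hc₀ hij
  refine ⟨3 * C, by linarith, ?_⟩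
  refine overwhelming_of_le (b := fun n => Real.exp (-(arcCount γ n : ℝ))) ?_
    (Real.tendsto_exp_neg_atTop_nhds_zero.comp
      (tendsto_natCast_atTop_atTop.comp (tendsto_arcCount γ)))
  filter_upwards [hmean, (tendsto_arcCount γ).eventually_gt_atTop 0,
    (tendsto_logPow hγ).eventually_ge_atTop 1] with n hmean hm hl
  have hm' : (0 : ℝ) < arcCount γ n := by exact_mod_cast hm
  -- The rectangle of all cells imposes no restriction on positions, so its mean bounds the total
  -- count.
  have hq := hmean (Finset.range (arcCount γ n)) le_rfl (Finset.range (arcCount γ n)) le_rfl rfl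
  have hZ : {z : ℝ × Torus d | c₀ * logPow γ n ≤ z.1 ∧
      arcIndex (arcCount γ n) (z.2 i) ∈ Finset.range (arcCount γ n) ∧
      arcIndex (arcCount γ n) (z.2 j) ∈ Finset.range (arcCount γ n)} =
      {z | c₀ * logPow γ n ≤ z.1} := by
    ext z
    simp [arcIndex_lt hm]
  rw [hZ, Finset.card_range, div_self hm'.ne', mul_one] at hq
  have hlaw := M.law_card_mark_mem_le n (Z := {z : ℝ × Torus d | c₀ * logPow γ n ≤ z.1})
    (measurable_fst measurableSet_Ici) (s := 1) zero_le_one le_rfl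
    (3 * C * logPow γ n ^ (3 - τ) * arcCount γ n)
  refine (measure_mono ?_).trans (hlaw.trans (ENNReal.ofReal_le_ofReal (Real.exp_le_exp.2 ?_)))
  · intro ω hω
    simp only [Set.mem_compl_iff, Set.mem_ofPred_eq, not_le] at hω
    exact hω.le
  · have he := Real.exp_one_lt_d9
    have he1 := Real.exp_one_gt_d9
    have hK1 : 1 ≤ logPow γ n ^ (3 - τ) := Real.one_le_rpow hl (by linarith)
    have h1 : (arcCount γ n : ℝ) ≤ C * logPow γ n ^ (3 - τ) * arcCount γ n :=
      le_mul_of_one_le_left hm'.le (by nlinarith)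
    have h2 : (Real.exp 1 - 1) * (n * M.vertexLaw.real {z | c₀ * logPow γ n ≤ z.1}) ≤
        2 * (C * logPow γ n ^ (3 - τ) * arcCount γ n) := by
      gcongr
      linarith
    linarith

/-- A random vertex set is expanding if it contains all vertices of weight in
`[c₁ log^γ n, c₂ log^γ n]` and all its vertices have weight at least `c₀ log^γ n`. -/
theorem exists_whpExpander_of_sandwich (hd : 2 ≤ d) {γ : ℝ} (hα : 0 < α) (hτ : 2 < τ) (hτ3 : τ < 3)
    (hγ : 1 / (3 - τ) < γ) {c₀ c₁ c₂ : ℝ} (hc₀ : 0 < c₀) (hc₁ : 0 < c₁) (hc₂ : c₁ < c₂)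
    {V' : (n : ℕ) → Sample d n → Set (Fin n)}
    (hV' : M.Overwhelming fun n => {ω |
      (∀ v, ω.1 v ∈ Set.Icc (c₁ * logPow γ n) (c₂ * logPow γ n) → v ∈ V' n ω) ∧
        ∀ v ∈ V' n ω, c₀ * logPow γ n ≤ ω.1 v}) :
    ∃ ε : ℝ, 0 < ε ∧ M.WhpExpander (3 / 2) γ ε V' := by
  have hγ0 : 0 < γ := lt_trans (by have : 0 < 3 - τ := by linarith
                                   positivity) hγ
  set i : Fin d := ⟨0, by omega⟩
  set j : Fin d := ⟨1, by omega⟩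
  have hij : i ≠ j := by simp [i, j]
  obtain ⟨κ₁, hκ₁, hE₁⟩ := M.exists_overwhelming_le_ncard_nbhd (by omega) hα hτ hτ3 hγ hc₀ hc₁ hc₂ i
  obtain ⟨κ₂, hκ₂, hE₂⟩ := M.exists_overwhelming_le_ncard_nbhd (by omega) hα hτ hτ3 hγ hc₀ hc₁ hc₂ j
  obtain ⟨δ₀, hδ₀, hE₃⟩ := M.exists_overwhelming_rectangle_le (by linarith) hγ0 hc₀ hij
  obtain ⟨C, hC, hE₄⟩ := M.exists_overwhelming_ncard_weight_le (by linarith) hτ3 hγ0 hc₀ hij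
  set κ := min κ₁ κ₂ with hκdef
  have hκ : 0 < κ := lt_min hκ₁ hκ₂
  -- This δ and the ε below satisfy the smallness conditions of `isExpandingSet_of_two_partitions`.
  set δ := min δ₀ (min 1 (κ ^ 2 / 4)) with hδdef
  have hδ : 0 < δ := by positivity
  have hδκ : δ ≤ κ ^ 2 / 4 := (min_le_right _ _).trans (min_le_right _ _)
  set ε := min 1 (min (κ / (40 * C)) (κ * δ / (2 * C))) with hεdef
  have hε : 0 < ε := by positivity
  have hε1 : ε ≤ κ / (40 * C) := (min_le_right _ _).trans (min_le_left _ _)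
  have hε2 : ε ≤ κ * δ / (2 * C) := (min_le_right _ _).trans (min_le_right _ _)
  rw [le_div_iff₀ (by positivity)] at hε1 hε2
  refine ⟨ε, hε, Overwhelming.whp ?_⟩
  refine (hV'.inter ((hE₁.inter hE₂).inter (hE₃.inter hE₄))).mono ?_
  have hKlim : Tendsto (fun n => logPow γ n ^ (3 - τ)) atTop atTop :=
    (tendsto_rpow_atTop (by linarith)).comp (tendsto_logPow hγ0)
  filter_upwards [hKlim.eventually_ge_atTop (40 / κ),
    (tendsto_arcCount γ).eventually_gt_atTop 0] with n hK hm
  rintro ω ⟨⟨hV1, hV2⟩, ⟨h₁, h₂⟩, h₃, h₄⟩ S hS hSε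
  simp only [Set.mem_ofPred_eq] at h₁ h₂ h₃ h₄
  have hK0 : 0 < logPow γ n ^ (3 - τ) := lt_of_lt_of_le (by positivity) hK
  have hcardT : Nat.card (V' n ω) = (V' n ω).ncard := Nat.card_coe_set_eq _
  have hinj : Function.Injective (Subtype.val : V' n ω → Fin n) := Subtype.val_injective
  have hnbr : ∀ (k : Fin d) (κ' : ℝ), κ ≤ κ' → (∀ v, c₀ * logPow γ n ≤ ω.1 v →
      κ' * logPow γ n ^ (3 - τ) ≤ ({u | ω.1 u ∈ Set.Icc (c₁ * logPow γ n) (c₂ * logPow γ n) ∧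
        (M.graph ω).Adj v u ∧ arcIndex (arcCount γ n) (ω.2.1 u k) =
          arcIndex (arcCount γ n) (ω.2.1 v k)} : Set (Fin n)).ncard) → ∀ v : V' n ω,
      κ * logPow γ n ^ (3 - τ) ≤ ({u | ((M.graph ω).induce (V' n ω)).Adj v u ∧
        arcIndex (arcCount γ n) (ω.2.1 u k) = arcIndex (arcCount γ n) (ω.2.1 v k)} :
          Set (V' n ω)).ncard := by
    intro k κ' hκ' h v
    refine ((mul_le_mul_of_nonneg_right hκ' hK0.le).trans (h v (hV2 v v.2))).trans ?_
    rw [← Set.ncard_image_of_injective _ hinj]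
    norm_cast
    refine Set.ncard_le_ncard ?_ (Set.toFinite _)
    rintro u ⟨hu1, hu2, hu3⟩
    -- The neighbours counted have weight in the window, so all of them lie in V' and survive in the
    -- induced subgraph.
    exact ⟨⟨u, hV1 u hu1⟩, ⟨hu2, hu3⟩, rfl⟩
  have key := isExpandingSet_of_two_partitions (H := (M.graph ω).induce (V' n ω))
    (f₀ := fun v => arcIndex (arcCount γ n) (ω.2.1 v i))
    (f₁ := fun v => arcIndex (arcCount γ n) (ω.2.1 v j)) (δ := δ) (M := C) (ε := ε)
    hm (fun _ => arcIndex_lt hm _) (fun _ => arcIndex_lt hm _) hκ hC hε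
    ((min_le_right _ _).trans (min_le_left _ _)) (by linarith) hK (min_le_left _ _) (by linarith)
    (by linarith) (hnbr i κ₁ (min_le_left _ _) h₁) (hnbr j κ₂ (min_le_right _ _) h₂) ?_ ?_
    hS (by rwa [hcardT])
  · rw [hcardT, logPow_rpow] at key
    have hexp : (1 - 1 / (3 / 2) : ℝ) = 1 / 3 := by norm_num
    rw [hexp]
    exact key
  · intro a ha1 ha2 A hA B hB hAa hBa
    refine le_trans ?_ (h₃ a ha1 (ha2.trans ?_) A hA B hB hAa hBa)
    · rw [← Set.ncard_image_of_injective _ hinj]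
      norm_cast
      refine Set.ncard_le_ncard ?_ (Set.toFinite _)
      rintro _ ⟨v, ⟨hv1, hv2⟩, rfl⟩
      exact ⟨hV2 v v.2, hv1, hv2⟩
    · gcongr
      exact min_le_left _ _
  · rw [hcardT]
    refine le_trans ?_ h₄
    norm_cast
    exact Set.ncard_le_ncard (fun v hv => hV2 v hv) (Set.toFinite _)

end MCDGIRG

end Rectangles

/-! ### From weights to degrees -/

section Degrees

/-- Since (e^s - 1)μ = sμ + O(s²), a small s > 0 gives the Chernoff exponent a definite sign. -/
lemma exists_pos_exp_sub_one_mul_lt {μ c : ℝ} (hμ : 0 ≤ μ) (h : μ < c) :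
    ∃ s : ℝ, 0 < s ∧ (Real.exp s - 1) * μ < s * c := by
  have hc : 0 < c := hμ.trans_lt h
  set s := min 1 ((c - μ) / (2 * c)) with hs
  have hs0 : 0 < s := lt_min one_pos (div_pos (by linarith) (by linarith))
  have hs1 : s ≤ 1 := min_le_left _ _
  have hs2 : s ≤ (c - μ) / (2 * c) := min_le_right _ _
  rw [le_div_iff₀ (by linarith)] at hs2
  have h1 := (abs_le.1 (Real.abs_exp_sub_one_sub_id_le (abs_le.2 ⟨by linarith, hs1⟩))).2
  refine ⟨s, hs0, ?_⟩
  calc (Real.exp s - 1) * μ ≤ (s + s ^ 2) * μ := by gcongr; linarith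
    _ = s * ((1 + s) * μ) := by ring
    _ < s * c := by
        gcongr
        nlinarith

lemma exists_neg_exp_sub_one_mul_lt {μ c : ℝ} (hc : 0 ≤ c) (h : c < μ) :
    ∃ s : ℝ, s < 0 ∧ (Real.exp s - 1) * μ < s * c := by
  have hμ : 0 < μ := hc.trans_lt h
  set s := min 1 ((μ - c) / (2 * μ)) with hs
  have hs0 : 0 < s := lt_min one_pos (div_pos (by linarith) (by linarith))
  have hs1 : s ≤ 1 := min_le_left _ _
  have hs2 : s ≤ (μ - c) / (2 * μ) := min_le_right _ _
  rw [le_div_iff₀ (by linarith)] at hs2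
  have h1 := (abs_le.1 (Real.abs_exp_sub_one_sub_id_le (x := -s)
    (abs_le.2 ⟨by linarith, by linarith⟩))).2
  refine ⟨-s, by linarith, ?_⟩
  calc (Real.exp (-s) - 1) * μ ≤ (-s + s ^ 2) * μ := by gcongr; linarith
    _ = s * (-((1 - s) * μ)) := by ring
    _ < s * (-c) := by
        gcongr
        nlinarith
    _ = -s * c := by ring

variable {d : ℕ} {τ α : ℝ}

namespace MCDGIRG

variable {M : MCDGIRG d τ α} {a b : ℝ}

lemma HasMeanDegreeBounds.overwhelming_deg_lt (hM : M.HasMeanDegreeBounds a b) (hb : 0 ≤ b)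
    {γ : ℝ} (hγ : 1 < γ) {l c : ℝ} (hl : 0 ≤ l) (h : b * l < c) :
    M.Overwhelming fun n => {ω | ∀ v, ω.1 v ∈ Set.Icc 1 (l * logPow γ n) →
      (M.deg ω v : ℝ) < c * logPow γ n} := by
  obtain ⟨δ, hδ, hM⟩ := hM
  obtain ⟨s, hs, hsc⟩ := exists_pos_exp_sub_one_mul_lt (by positivity) h
  refine overwhelming_forall
    (b := fun n => Real.exp (-((s * c - (Real.exp s - 1) * (b * l)) * logPow γ n))) ?_
    (tendsto_mul_exp_neg_logPow hγ (by linarith))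
  filter_upwards [hM, (tendsto_div_logPow γ).eventually_ge_atTop (l / δ),
    (tendsto_logPow (by linarith : 0 < γ)).eventually_gt_atTop 0] with n hM hn hpos v
  rw [div_le_div_iff₀ hδ hpos] at hn
  have hchern := M.law_thinnedNbhd_le v (M.measurable_edgeProb n v)
    (fun _ _ _ => M.prob_mem _ _ _ _ _ _ _) (Z := {z | z.1 ∈ Set.Icc 1 (l * logPow γ n)})
    (measurable_fst measurableSet_Icc) (s := s)
    (B := (Real.exp s - 1) * (b * (l * logPow γ n))) (fun z hz => by
      have he : 0 ≤ Real.exp s - 1 := by linarith [Real.add_one_le_exp s]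
      refine mul_le_mul_of_nonneg_left ?_ he
      exact (hM v z hz.1 (hz.2.trans (by linarith))).2.trans
        (mul_le_mul_of_nonneg_left hz.2 hb)) (c * logPow γ n)
  refine (measure_mono ?_).trans (hchern.trans (le_of_eq ?_))
  · intro ω hω
    simp only [Set.mem_ofPred_eq, Classical.not_imp, not_lt] at hω
    refine ⟨hω.1, ?_⟩
    rw [card_thinnedNbhd_edgeProb]
    exact mul_le_mul_of_nonneg_left hω.2 hs.le
  · congr 2
    ring

/-- Lower-tail Chernoff at scale log^γ n, summable over vertices because γ > 1. The cap l' keeps the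
weight below δn, where the mean-degree bounds are available. -/
lemma HasMeanDegreeBounds.overwhelming_lt_deg (hM : M.HasMeanDegreeBounds a b) (ha : 0 ≤ a)
    {γ : ℝ} (hγ : 1 < γ) {l l' c : ℝ} (hl : 0 < l) (hc : 0 ≤ c) (h : c < a * l) :
    M.Overwhelming fun n => {ω | ∀ v, ω.1 v ∈ Set.Icc (l * logPow γ n) (l' * logPow γ n) →
      c * logPow γ n < (M.deg ω v : ℝ)} := by
  obtain ⟨δ, hδ, hM⟩ := hM
  obtain ⟨s, hs, hsc⟩ := exists_neg_exp_sub_one_mul_lt hc h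
  refine overwhelming_forall
    (b := fun n => Real.exp (-((s * c - (Real.exp s - 1) * (a * l)) * logPow γ n))) ?_
    (tendsto_mul_exp_neg_logPow hγ (by linarith))
  filter_upwards [hM, (tendsto_div_logPow γ).eventually_ge_atTop (l' / δ),
    (tendsto_logPow (by linarith : 0 < γ)).eventually_gt_atTop 0,
    (tendsto_logPow (by linarith : 0 < γ)).eventually_ge_atTop (1 / l)] with n hM hn hpos h1 v
  rw [div_le_div_iff₀ hδ hpos] at hn
  rw [div_le_iff₀' hl] at h1
  have hchern := M.law_thinnedNbhd_le v (M.measurable_edgeProb n v)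
    (fun _ _ _ => M.prob_mem _ _ _ _ _ _ _)
    (Z := {z | z.1 ∈ Set.Icc (l * logPow γ n) (l' * logPow γ n)})
    (measurable_fst measurableSet_Icc) (s := s)
    (B := (Real.exp s - 1) * (a * (l * logPow γ n))) (fun z hz => by
      have he : Real.exp s - 1 ≤ 0 := by
        have := Real.exp_le_one_iff.2 hs.le
        linarith
      refine mul_le_mul_of_nonpos_left ?_ he
      exact (mul_le_mul_of_nonneg_left hz.1 ha).trans
        (hM v z (h1.trans hz.1) (hz.2.trans (by linarith))).1) (c * logPow γ n)
  refine (measure_mono ?_).trans (hchern.trans (le_of_eq ?_))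
  · intro ω hω
    simp only [Set.mem_ofPred_eq, Classical.not_imp, not_lt] at hω
    refine ⟨hω.1, ?_⟩
    rw [card_thinnedNbhd_edgeProb]
    exact mul_le_mul_of_nonpos_left hω.2 hs.le
  · congr 2
    ring

/-- Vertices of degree at least `c log^γ n` have weight at least `c / (2 b) log^γ n`. -/
lemma HasMeanDegreeBounds.overwhelming_weight_of_deg (hM : M.HasMeanDegreeBounds a b) (hb : 0 < b)
    {γ : ℝ} (hγ : 1 < γ) {c : ℝ} (hc : 0 < c) :
    M.Overwhelming fun n => {ω | ∀ v, c * logPow γ n ≤ M.deg ω v →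
      c / (2 * b) * logPow γ n ≤ ω.1 v} := by
  have h : b * (c / (2 * b)) < c := by
    have : b * (c / (2 * b)) = c / 2 := by field_simp
    linarith
  refine (M.overwhelming_one_le.inter (hM.overwhelming_deg_lt hb.le hγ (by positivity) h)).mono
    (Eventually.of_forall fun n ω hω v hv => ?_)
  by_contra! hcon
  exact (hω.2 v ⟨hω.1 v, hcon.le⟩).not_ge hv

lemma HasMeanDegreeBounds.exists_whpExpander_degreeAtLeast (hM : M.HasMeanDegreeBounds a b)
    (ha : 0 < a) (hb : 0 < b) (hd : 2 ≤ d) {γ : ℝ} (hα : 0 < α) (hτ : 2 < τ) (hτ3 : τ < 3)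
    (hγ : 1 / (3 - τ) < γ) (hγ1 : 1 < γ) {c : ℝ} (hc : 0 < c) :
    ∃ ε : ℝ, 0 < ε ∧ M.WhpExpander (3 / 2) γ ε (M.degreeAtLeast γ c) := by
  have h : c < a * (2 * c / a) := by
    have : a * (2 * c / a) = 2 * c := by field_simp
    linarith
  refine M.exists_whpExpander_of_sandwich hd hα hτ hτ3 hγ (c₀ := c / (2 * b)) (c₁ := 2 * c / a)
    (c₂ := 3 * c / a) (by positivity) (by positivity) (by gcongr; norm_num) ?_
  refine ((hM.overwhelming_weight_of_deg hb hγ1 hc).inter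
    (hM.overwhelming_lt_deg ha.le hγ1 (l' := 3 * c / a) (by positivity) hc.le h)).mono
    (Eventually.of_forall fun n ω hω => ⟨fun v hv => (hω.2 v hv).le, fun v hv => hω.1 v hv⟩)

/-- Weights strictly between c₁/a and c₂/b (times log^γ n) have mean degrees strictly inside the
prescribed range; the hypothesis on c₂ says exactly that this gap is nonempty. -/
lemma HasMeanDegreeBounds.exists_whpExpander_degreeIn (hM : M.HasMeanDegreeBounds a b)
    (ha : 0 < a) (hb : 0 < b) (hd : 2 ≤ d) {γ : ℝ} (hα : 0 < α) (hτ : 2 < τ) (hτ3 : τ < 3)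
    (hγ : 1 / (3 - τ) < γ) (hγ1 : 1 < γ) {c₁ c₂ : ℝ} (hc₁ : 0 < c₁) (hc₂ : b / a * c₁ < c₂) :
    ∃ ε : ℝ, 0 < ε ∧ M.WhpExpander (3 / 2) γ ε (M.degreeIn γ c₁ c₂) := by
  have h : c₁ / a < c₂ / b := by
    rw [lt_div_iff₀ hb]
    calc c₁ / a * b = b / a * c₁ := by ring
      _ < c₂ := hc₂
  obtain ⟨l, hl1, hl2⟩ := exists_between h
  obtain ⟨l', hl'1, hl'2⟩ := exists_between hl2
  have hl0 : 0 < l := lt_trans (by positivity) hl1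
  rw [div_lt_iff₀' ha] at hl1
  rw [lt_div_iff₀' hb] at hl'2
  refine M.exists_whpExpander_of_sandwich hd hα hτ hτ3 hγ (c₀ := c₁ / (2 * b)) (c₁ := l)
    (c₂ := l') (by positivity) hl0 hl'1 ?_
  refine ((M.overwhelming_one_le.inter (hM.overwhelming_weight_of_deg hb hγ1 hc₁)).inter
    ((hM.overwhelming_lt_deg ha.le hγ1 (l' := l') hl0 hc₁.le hl1).inter
      (hM.overwhelming_deg_lt hb.le hγ1 (hl0.trans hl'1).le hl'2))).mono
    (Eventually.of_forall fun n ω hω => ⟨fun v hv => ⟨(hω.2.1 v hv).le, ?_⟩, fun v hv => ?_⟩)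
  · exact (hω.2.2 v ⟨hω.1.1 v, hv.2⟩).le
  · exact hω.1.2 v hv.1

end MCDGIRG

end Degrees

/-! ### The main theorem -/

theorem theorem1 (d : ℕ) (hd : 2 ≤ d) :
    ∃ c : ℝ, 1 < c ∧
      ∀ (τ α γ : ℝ), 2 < τ → τ < 3 → 1 < α → 1 / (3 - τ) < γ →
        ∀ M : MCDGIRG d τ α,
          (∀ c' : ℝ, 0 < c' →
            ∃ ε : ℝ, 0 < ε ∧ M.WhpExpander c γ ε (M.weightAtLeast γ c')) ∧
          (∀ c₁' c₂' : ℝ, 0 < c₁' → c₁' < c₂' →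
            ∃ ε : ℝ, 0 < ε ∧ M.WhpExpander c γ ε (M.weightIn γ c₁' c₂')) ∧
          (∀ c' : ℝ, 0 < c' →
            ∃ ε : ℝ, 0 < ε ∧ M.WhpExpander c γ ε (M.degreeAtLeast γ c')) ∧
          (∃ R : ℝ, 1 ≤ R ∧ ∀ c₁' c₂' : ℝ, 0 < c₁' → R * c₁' < c₂' →
            ∃ ε : ℝ, 0 < ε ∧ M.WhpExpander c γ ε (M.degreeIn γ c₁' c₂')) ∧
          (M.AsymptoticallyHomogeneous → ∀ c₁' c₂' : ℝ, 0 < c₁' → c₁' < c₂' →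
            ∃ ε : ℝ, 0 < ε ∧ M.WhpExpander c γ ε (M.degreeIn γ c₁' c₂')) := by
  refine ⟨3 / 2, by norm_num, fun τ α γ hτ hτ3 hα hγ M => ?_⟩
  have hd0 : 0 < d := by omega
  have hα0 : 0 < α := by linarith
  have hγ1 : 1 < γ := by
    refine lt_of_le_of_lt ?_ hγ
    rw [one_le_div (by linarith)]
    linarith
  obtain ⟨a, b, ha, hab, hM⟩ := M.exists_hasMeanDegreeBounds hd0 hτ hα
  have hb : 0 < b := ha.trans_le hab
  -- R is the ratio of the mean-degree constants.
  refine ⟨fun c hc => ?_, fun c₁ c₂ hc₁ hc₂ => ?_, fun c hc => ?_, ⟨b / a, ?_, ?_⟩, ?_⟩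
  · exact M.exists_whpExpander_of_sandwich hd hα0 hτ hτ3 hγ (c₁ := c) (c₂ := 2 * c) hc hc
      (by linarith) (M.overwhelming_one_le.mono (Eventually.of_forall fun n ω _ =>
        ⟨fun v hv => hv.1, fun v hv => hv⟩))
  · exact M.exists_whpExpander_of_sandwich hd hα0 hτ hτ3 hγ hc₁ hc₁ hc₂
      (M.overwhelming_one_le.mono (Eventually.of_forall fun n ω _ =>
        ⟨fun v hv => hv, fun v hv => hv.1⟩))
  · exact hM.exists_whpExpander_degreeAtLeast ha hb hd hα0 hτ hτ3 hγ hγ1 hc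
  · rwa [one_le_div ha]
  · exact fun c₁ c₂ hc₁ hc₂ =>
      hM.exists_whpExpander_degreeIn ha hb hd hα0 hτ hτ3 hγ hγ1 hc₁ hc₂
  · intro hhom c₁ c₂ hc₁ hc₂
    -- Homogeneity permits any ratio above 1, here c₂/c₁. Replacing b' by max(a', b') ensures
    -- positivity and keeps the ratio below c₂/c₁.
    obtain ⟨a', b', ha', hab', hM'⟩ := hhom.exists_hasMeanDegreeBounds hd0 hτ hα
      ((one_lt_div hc₁).2 hc₂)
    have hb' : 0 < max a' b' := lt_max_of_lt_left ha'
    have hmax : M.HasMeanDegreeBounds a' (max a' b') := by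
      obtain ⟨δ, hδ, h⟩ := hM'
      refine ⟨δ, hδ, h.mono fun n hn v z hz1 hz2 => ?_⟩
      have := hn v z hz1 hz2
      exact ⟨this.1, this.2.trans (by gcongr; exact le_max_right _ _)⟩
    refine hmax.exists_whpExpander_degreeIn ha' hb' hd hα0 hτ hτ3 hγ hγ1 hc₁ ?_
    have h1 : max a' b' < c₂ / c₁ * a' :=
      max_lt (by have := (one_lt_div hc₁).2 hc₂; nlinarith) hab'
    calc max a' b' / a' * c₁ < (c₂ / c₁ * a') / a' * c₁ := by gcongr
      _ = c₂ := by field_simp
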